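/- Let $K$ be a field with $\operatorname{char} K \neq 2$, and let $\mathrm{GA}_2(K)$ be the group, under composition, of polynomial maps $(x,y)\mapsto (P(x,y),Q(x,y))$ with $P,Q\in K[x,y]$ that have a polynomial inverse (maps being distinguished by their defining polynomials). Let $\mathcal A\subset \mathrm{GA}_2(K)$ be the subgroup of affine maps $\mathbf x\mapsto M\mathbf x+\mathbf a$ with $M\in \mathrm{GL}(2,K)$, $\mathbf a\in K^2$, and let $\mathcal E\subset \mathrm{GA}_2(K)$ be the subgroup of elementary maps $(x,y)\mapsto(\alpha x+P(y),\beta y+v)$ with $P\in K[y]$, $\alpha,\beta,v\in K$, $\alpha\beta\neq 0$. Identify a matrix $M\in\mathrm{GL}(2,K)$ with the linear map $\mathbf x\mapsto M\mathbf x$. Call $g$ an involution if $g^2=1\neq g$; conjugate means conjugate in $\mathrm{GA}_2(K)$. Then every involution in $\mathcal A\cup\mathcal E$, and likewise every involution in $\mathrm{GA}_2(K)$, is conjugate to a linear map. More precisely, it is conjugate to $I=\operatorname{diag}(-1,-1)$ or to $S=\operatorname{diag}(-1,1)$. Moreover, $S$ is conjugate to $T=\begin{pmatrix}0&1\\1&0\end{pmatrix}$,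 so that $S$ may be replaced by $T$, and $T$ belongs to the set $\left\{\begin{pmatrix}0&1\\1&\beta\end{pmatrix} : \beta\in K\right\}$. -/

import Mathlib

open MvPolynomial

noncomputable section

/-- A polynomial map `(x, y) ↦ (P(x, y), Q(x, y))` of the plane over `K`, given by its pair of
coordinate polynomials (`x = X 0`, `y = X 1`). Maps are distinguished by their polynomials, not by
the functions on `K²` that they induce. -/
@[ext]
structure PlanePolyMap (K : Type*) [Field K] where
  coord : Fin 2 → MvPolynomial (Fin 2) K

namespace PlanePolyMap

variable {K : Type*} [Field K]

/-- Polynomial maps form a monoid under composition: `f * g` is `f ∘ g`, that is, the coordinates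
of `g` are substituted into those of `f`. -/
instance : Monoid (PlanePolyMap K) where
  mul f g := ⟨fun i => aeval g.coord (f.coord i)⟩
  one := ⟨fun i => X i⟩
  mul_assoc f g h := by
    ext1
    funext i
    change aeval h.coord (aeval g.coord (f.coord i))
      = aeval (fun j => aeval h.coord (g.coord j)) (f.coord i)
    rw [← AlgHom.comp_apply, comp_aeval]
  one_mul f := by
    ext1
    funext i
    exact aeval_X _ _
  mul_one f := by
    ext1
    funext i
    exact aeval_X_left_apply _

/-- The linear map `x ↦ M x` as a polynomial map. -/
def ofMatrix : Matrix (Fin 2) (Fin 2) K →* PlanePolyMap K where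
  toFun M := ⟨fun i => ∑ j, C (M i j) * X j⟩
  map_one' := by
    ext1
    funext i
    change ∑ j, C ((1 : Matrix (Fin 2) (Fin 2) K) i j) * X j = X i
    simp [Matrix.one_apply, apply_ite C, ite_mul]
  map_mul' M N := by
    ext1
    funext i
    change ∑ j, C ((M * N) i j) * X j
      = aeval (fun j => ∑ k, C (N j k) * X k) (∑ j, C (M i j) * X j)
    simp [Matrix.mul_apply, Fin.sum_univ_two, algebraMap_eq]
    ring

end PlanePolyMap

/-- The group `GA₂(K)` of polynomial automorphisms of the plane: the polynomial maps that have a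
polynomial inverse, under composition. -/
abbrev GA2 (K : Type*) [Field K] := (PlanePolyMap K)ˣ

namespace GA2

variable {K : Type*} [Field K]

/-- A matrix `M ∈ GL(2, K)` regarded as the linear automorphism `x ↦ M x`. -/
def linear : GL (Fin 2) K →* GA2 K := Units.map PlanePolyMap.ofMatrix

variable (K)

/-- The affine automorphisms `x ↦ M x + a` with `M ∈ GL(2, K)` and `a ∈ K²`. -/
def affine : Set (GA2 K) :=
  {g | ∃ (a : Fin 2 → K) (M : GL (Fin 2) K),
    ∀ i, g.val.coord i = ∑ j, C (M i j) * X j + C (a i)}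

/-- The elementary automorphisms `(x, y) ↦ (α x + P(y), β y + v)` with `α β ≠ 0`. -/
def elementary : Set (GA2 K) :=
  {g | ∃ (α β v : K) (P : Polynomial K), α * β ≠ 0 ∧
    g.val.coord 0 = C α * X 0 + Polynomial.aeval (X 1) P ∧
    g.val.coord 1 = C β * X 1 + C v}

/-- The matrix `diag(-1, -1)`. -/
def matI : GL (Fin 2) K where
  val := !![-1, 0; 0, -1]
  inv := !![-1, 0; 0, -1]
  val_inv := by simp [Matrix.one_fin_two]
  inv_val := by simp [Matrix.one_fin_two]

/-- The matrix `diag(-1, 1)`. -/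
def matS : GL (Fin 2) K where
  val := !![-1, 0; 0, 1]
  inv := !![-1, 0; 0, 1]
  val_inv := by simp [Matrix.one_fin_two]
  inv_val := by simp [Matrix.one_fin_two]

/-- The coordinate swap `[[0, 1], [1, 0]]`. -/
def matT : GL (Fin 2) K where
  val := !![0, 1; 1, 0]
  inv := !![0, 1; 1, 0]
  val_inv := by simp [Matrix.one_fin_two]
  inv_val := by simp [Matrix.one_fin_two]

/-- The set of linear automorphisms with matrix `[[0, 1], [1, β]]`, `β ∈ K`. -/
def affineReps : Set (GA2 K) :=
  {g | ∃ (β : K) (M : GL (Fin 2) K), M.val = !![0, 1; 1, β] ∧ g = linear M}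

variable {K}

/-- An involution is an element of order exactly two: `g² = 1 ≠ g`. -/
def IsInvolution (g : GA2 K) : Prop := g ^ 2 = 1 ∧ g ≠ 1

end GA2

end

/-! An involution `g` that is affine or elementary has an obvious linear part `L` with `L² = 1`, and
away from characteristic 2 the average `h = (1 + L g)/2` satisfies `h g = L h`. For such `g` this
`h` is a translation, or a shear followed by a translation, so it is invertible and `g` is conjugate
to `L`. A linear involution other than `I` has both eigenvalues 1 and -1, hence is similar to `S`.

A general involution is brought into the union of affine and elementary maps by conjugation. These
maps generate the whole group (Jung–van der Kulk, `mem_closure_affine_union_elementary`), and cyclic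
reduction of a word leaves either a single factor or a product of pairs `e * a` with `e` elementary
but not affine and `a` affine but not elementary (`exists_isConj_mem_or_isPairProduct`). Each pair
strictly raises the degree of the first coordinate of suitable maps, so such a product is not an
involution (`sq_ne_one_of_isPairProduct`).

Generation is a Euclidean algorithm on the degrees of the two coordinates restricted to the line `y
= 0`. It never stalls, because one degree divides the other (`natDegree_axis_dvd_or_dvd`). Otherwise
a leading form of a coordinate of the inverse would have a factor `x ^ m - c y ^ n` with `m, n ≥ 2`
coprime. The additive group action that fixes this coordinate and translates the other would then
have a nontrivial leading part fixing `x ^ m - c y ^ n`, which the rigidity statement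
`eq_C_of_pow_sub_pow` forbids in every characteristic. -/

noncomputable section

/-! ### Linearisation of linear, affine and elementary involutions -/

namespace PlanePolyMap

variable {K : Type*} [Field K]

theorem mul_coord (f g : PlanePolyMap K) (i : Fin 2) :
    (f * g).coord i = aeval g.coord (f.coord i) := rfl

theorem one_coord (i : Fin 2) : (1 : PlanePolyMap K).coord i = X i := rfl

theorem ofMatrix_coord (M : Matrix (Fin 2) (Fin 2) K) (i : Fin 2) :
    (ofMatrix M).coord i = C (M i 0) * X 0 + C (M i 1) * X 1 :=
  Fin.sum_univ_two _

theorem ext_coord {f g : PlanePolyMap K} (h0 : f.coord 0 = g.coord 0)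
    (h1 : f.coord 1 = g.coord 1) : f = g := by
  ext1
  funext i
  fin_cases i
  exacts [h0, h1]

end PlanePolyMap

namespace GA2

open PlanePolyMap

variable {K : Type*} [Field K]

theorem linear_coord (M : GL (Fin 2) K) (i : Fin 2) :
    (linear M).val.coord i = C (M.val i 0) * X 0 + C (M.val i 1) * X 1 :=
  ofMatrix_coord _ _

/-- The translation `x ↦ x + a`. -/
def shift (a : Fin 2 → K) : GA2 K where
  val := ⟨fun i => X i + C (a i)⟩
  inv := ⟨fun i => X i - C (a i)⟩
  val_inv := by
    ext1
    funext i
    simp [mul_coord, one_coord, algebraMap_eq]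
  inv_val := by
    ext1
    funext i
    simp [mul_coord, one_coord, algebraMap_eq]

/-- The shear `(x, y) ↦ (x + P(y), y)`. -/
def shear (P : Polynomial K) : GA2 K where
  val := ⟨![X 0 + Polynomial.aeval (X 1) P, X 1]⟩
  inv := ⟨![X 0 - Polynomial.aeval (X 1) P, X 1]⟩
  val_inv := by
    apply ext_coord <;> simp [mul_coord, one_coord, ← Polynomial.aeval_algHom_apply]
  inv_val := by
    apply ext_coord <;> simp [mul_coord, one_coord, ← Polynomial.aeval_algHom_apply]

theorem shift_coord (a : Fin 2 → K) (i : Fin 2) :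
    (shift a).val.coord i = X i + C (a i) := rfl

theorem shear_coord_zero (P : Polynomial K) :
    (shear P).val.coord 0 = X 0 + Polynomial.aeval (X 1) P := rfl

theorem shear_coord_one (P : Polynomial K) : (shear P).val.coord 1 = X 1 := rfl

theorem isConj_of_mul_eq {g l : GA2 K} (h : GA2 K) (e : h * g = l * h) : IsConj g l :=
  isConj_iff.2 ⟨h, by rw [e, mul_inv_cancel_right]⟩

theorem isConj_linear {M N : GL (Fin 2) K} (h : IsConj M N) : IsConj (linear M) (linear N) :=
  linear.map_isConj h

theorem linear_injective : Function.Injective (linear : GL (Fin 2) K → GA2 K) := by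
  intro M N h
  have hc : ∀ i, C (M.val i 0) * X 0 + C (M.val i 1) * X 1
      = (C (N.val i 0) * X 0 + C (N.val i 1) * X 1 : MvPolynomial (Fin 2) K) := fun i => by
    rw [← linear_coord, ← linear_coord, h]
  ext i j
  have h0 := congrArg (eval ![1, 0]) (hc i)
  have h1 := congrArg (eval ![0, 1]) (hc i)
  simp at h0 h1
  fin_cases j
  exacts [h0, h1]

/-- Since `(M + 1)(M - 1) = 0`, nonzero values of `M - 1` and `M + 1` are eigenvectors for -1 and 1.
They are independent because `2 ≠ 0`, and they form the columns of the conjugating matrix. -/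
theorem isConj_matS_of_sq_eq_one (h2 : (2 : K) ≠ 0) {M : GL (Fin 2) K} (hM : M ^ 2 = 1)
    (h1 : M ≠ 1) (hI : M ≠ matI K) : IsConj M (matS K) := by
  have hsq : M.val * M.val = 1 := by
    rw [← Units.val_mul, ← pow_two, hM, Units.val_one]
  obtain ⟨u, hu⟩ : ∃ u : Fin 2 → K, (M.val - 1).mulVec u ≠ 0 := by
    by_contra! hc
    apply h1
    ext1
    rw [Units.val_one, ← sub_eq_zero]
    exact Matrix.ext_of_mulVec_single fun i => by rw [hc, Matrix.zero_mulVec]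
  obtain ⟨v, hv⟩ : ∃ v : Fin 2 → K, (M.val + 1).mulVec v ≠ 0 := by
    by_contra! hc
    apply hI
    have : M.val + 1 = 0 := Matrix.ext_of_mulVec_single fun i => by
      rw [hc, Matrix.zero_mulVec]
    have h' := eq_neg_of_add_eq_zero_left this
    ext i j
    rw [h']
    fin_cases i <;> fin_cases j <;> simp [matI]
  set a := (M.val - 1).mulVec u with ha
  set b := (M.val + 1).mulVec v with hb
  have hMa : M.val.mulVec a = -a := by
    rw [ha, Matrix.mulVec_mulVec, mul_sub, hsq, mul_one, ← Matrix.neg_mulVec, neg_sub]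
  have hMb : M.val.mulVec b = b := by
    rw [hb, Matrix.mulVec_mulVec, mul_add, hsq, mul_one, add_comm]
  have hdet : (Matrix.of ![![a 0, b 0], ![a 1, b 1]]).det ≠ 0 := by
    intro hd
    rw [Matrix.det_fin_two] at hd
    simp at hd
    have key : ∀ s t : K, (∀ i, s * a i + t * b i = 0) → s = 0 ∧ t = 0 := by
      intro s t hst
      have e : s • a + t • b = 0 := by
        ext i
        simpa using hst i
      have e' : -(s • a) + t • b = 0 := by
        have := congrArg M.val.mulVec e
        rwa [Matrix.mulVec_add, Matrix.mulVec_smul, Matrix.mulVec_smul, hMa, hMb,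
          Matrix.mulVec_zero, smul_neg] at this
      have et : (2 * t) • b = 0 := by
        rw [mul_smul, two_smul]
        calc t • b + t • b = (s • a + t • b) + (-(s • a) + t • b) := by abel
          _ = 0 := by rw [e, e', add_zero]
      have ht : t = 0 := by
        rcases smul_eq_zero.1 et with h | h
        · exact (mul_eq_zero.1 h).resolve_left h2
        · exact absurd h hv
      rw [ht, zero_smul, add_zero] at e
      exact ⟨(smul_eq_zero.1 e).resolve_right hu, ht⟩
    apply hu
    ext i
    -- If the determinant vanishes, each row of the matrix yields a linear relation between `a` and
    -- `b`; its triviality kills one entry of `a`.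
    have k0 := key (b 0) (-a 0) (by
      intro i
      fin_cases i <;> simp
      · ring
      · linear_combination -hd)
    have k1 := key (b 1) (-a 1) (by
      intro i
      fin_cases i <;> simp
      · linear_combination hd
      · ring)
    fin_cases i
    · simpa using k0.2
    · simpa using k1.2
  refine (isConj_iff.2 ⟨Matrix.GeneralLinearGroup.mkOfDetNeZero _ hdet, ?_⟩).symm
  rw [mul_inv_eq_iff_eq_mul]
  ext i j
  have hi := congrFun hMa i
  have hi' := congrFun hMb i
  simp only [Matrix.mulVec, dotProduct, Fin.sum_univ_two, Pi.neg_apply] at hi hi'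
  fin_cases i <;> fin_cases j <;>
    simp_all [Matrix.GeneralLinearGroup.mkOfDetNeZero, matS, Matrix.mul_apply, Fin.sum_univ_two]

theorem isConj_matT_matS (h2 : (2 : K) ≠ 0) : IsConj (matT K) (matS K) := by
  apply isConj_matS_of_sq_eq_one h2
  · ext i j
    fin_cases i <;> fin_cases j <;> simp [matT, pow_two]
  · intro h
    have := congrArg (fun M : GL (Fin 2) K => M.val 0 1) h
    simp [matT] at this
  · intro h
    have := congrArg (fun M : GL (Fin 2) K => M.val 0 1) h
    simp [matT, matI] at this

theorem IsInvolution.isConj {g l : GA2 K} (hg : IsInvolution g) (h : IsConj g l) :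
    IsInvolution l := by
  obtain ⟨c, rfl⟩ := isConj_iff.1 h
  refine ⟨by rw [conj_pow, hg.1, mul_one, mul_inv_cancel], fun e => hg.2 ?_⟩
  rwa [mul_inv_eq_one, mul_eq_left] at e

theorem isConj_linear_matI_or_matS (h2 : (2 : K) ≠ 0) {M : GL (Fin 2) K}
    (hM : IsInvolution (linear M)) :
    IsConj (linear M) (linear (matI K)) ∨ IsConj (linear M) (linear (matS K)) := by
  by_cases hI : M = matI K
  · exact Or.inl (hI ▸ IsConj.refl _)
  · refine Or.inr (isConj_linear (isConj_matS_of_sq_eq_one h2 ?_ ?_ hI))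
    · exact linear_injective (by rw [map_pow, hM.1, map_one])
    · rintro rfl
      exact hM.2 (map_one _)

theorem exists_isConj_linear_of_affine (h2 : (2 : K) ≠ 0) {g : GA2 K} (hg : g ∈ affine K)
    (hs : g ^ 2 = 1) : ∃ M : GL (Fin 2) K, IsConj g (linear M) := by
  obtain ⟨a, M, hM⟩ := hg
  simp only [Fin.sum_univ_two] at hM
  have hs' : g.val * g.val = 1 := by rw [← Units.val_mul, ← pow_two, hs, Units.val_one]
  have hc : ∀ i, M.val i 0 * a 0 + M.val i 1 * a 1 + a i = 0 := by
    intro i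
    have := congrArg (fun f : PlanePolyMap K => eval ![0, 0] (f.coord i)) hs'
    simp only [mul_coord, hM, one_coord] at this
    fin_cases i <;> simpa [algebraMap_eq, hM] using this
  -- The midpoint `a / 2` of the origin and its image `a` is fixed by `g`; the translation moves it
  -- to the origin.
  refine ⟨M, isConj_of_mul_eq (shift fun i => -a i / 2) ?_⟩
  ext1
  ext1
  funext i
  have e : -(a i) / 2 + a i = M.val i 0 * (-a 0 / 2) + M.val i 1 * (-a 1 / 2) := by
    field_simp
    linear_combination hc i
  simp only [Units.val_mul, mul_coord, shift_coord, linear_coord, map_add, map_mul, aeval_X,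
    aeval_C, algebraMap_eq, hM]
  have e' := congrArg (C : K → MvPolynomial (Fin 2) K) e
  simp only [map_add, map_mul] at e'
  linear_combination e'

theorem exists_isConj_linear_of_elementary (h2 : (2 : K) ≠ 0) {g : GA2 K}
    (hg : g ∈ elementary K) (hs : g ^ 2 = 1) : ∃ M : GL (Fin 2) K, IsConj g (linear M) := by
  obtain ⟨α, β, v, P, hαβ, h0, h1⟩ := hg
  have hs' : g.val * g.val = 1 := by rw [← Units.val_mul, ← pow_two, hs, Units.val_one]
  have e0 := congrArg (fun f : PlanePolyMap K => f.coord 0) hs'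
  have e1 := congrArg (fun f : PlanePolyMap K => f.coord 1) hs'
  simp only [mul_coord, one_coord, h0, h1, map_add, map_mul, aeval_X, aeval_C, algebraMap_eq,
    ← Polynomial.aeval_algHom_apply] at e0 e1
  have hα : α * α = 1 := by
    -- The contributions of `P` depend only on `y`, so they cancel in the difference of the values
    -- at `(1, 0)` and `(0, 0)`.
    have a0 := congrArg (aeval ![(1 : K), 0]) e0
    have a1 := congrArg (aeval ![(0 : K), 0]) e0
    simp only [map_add, map_mul, aeval_X, aeval_C, ← Polynomial.aeval_algHom_apply] at a0 a1
    simp at a0 a1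
    linear_combination a0 - a1
  have hβ : β * v + v = 0 := by
    simpa using congrArg (eval ![0, 0]) e1
  have hα' := congrArg (C : K → MvPolynomial (Fin 2) K) hα
  have hβ' := congrArg (C : K → MvPolynomial (Fin 2) K) hβ
  have h2' : C (2⁻¹ : K) * 2 = (1 : MvPolynomial (Fin 2) K) := by
    rw [← map_ofNat C 2, ← map_mul, inv_mul_cancel₀ h2, map_one]
  simp only [map_add, map_mul, map_one, map_zero] at hα' hβ'
  have hdet : (Matrix.of ![![α, 0], ![0, β]]).det ≠ 0 := by
    simpa [Matrix.det_fin_two] using hαβ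
  -- This is the average `(1 + L g)/2` with `L = diag(α, β)`, simplified by `α² = 1` and `β v = -v`.
  refine ⟨Matrix.GeneralLinearGroup.mkOfDetNeZero _ hdet,
    isConj_of_mul_eq (shift ![0, -2⁻¹ * v] * shear (Polynomial.C (2⁻¹ * α) * P)) ?_⟩
  ext1
  apply ext_coord
  · simp only [Units.val_mul, mul_coord, shift_coord, shear_coord_zero, shear_coord_one,
      linear_coord, map_add, map_mul, aeval_X, aeval_C, algebraMap_eq, h0, h1,
      ← Polynomial.aeval_algHom_apply, Polynomial.aeval_C]
    simp [Matrix.GeneralLinearGroup.mkOfDetNeZero]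
    linear_combination C 2⁻¹ * C α * e0 - C 2⁻¹ * C α * X 0 * hα' - (Polynomial.aeval (X 1) P) * h2'
      - 2 * C 2⁻¹ * (Polynomial.aeval (X 1) P) * hα'
  · simp only [Units.val_mul, mul_coord, shift_coord, shear_coord_one,
      linear_coord, map_add, map_mul, aeval_X, aeval_C, algebraMap_eq, h1]
    simp [Matrix.GeneralLinearGroup.mkOfDetNeZero]
    linear_combination C 2⁻¹ * hβ' - C v * h2'

end GA2

/-- The nonempty products of pairs `e * a` with `e ∈ E \ A` and `a ∈ A \ E`. -/
inductive IsPairProduct {G : Type*} [Group G] (A E : Set G) : G → Prop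
  | pair {e a : G} : e ∈ E → e ∉ A → a ∈ A → a ∉ E → IsPairProduct A E (e * a)
  | cons {e a g : G} : e ∈ E → e ∉ A → a ∈ A → a ∉ E → IsPairProduct A E g →
      IsPairProduct A E (e * a * g)

/-! ### Cyclic reduction of words in two multiplicatively closed sets -/

section Words

variable {G : Type*} [Group G] {A E : Set G}

theorem isPairProduct_of_isChain (n : ℕ) : ∀ l : List G, l.length ≤ n →
    (∀ x ∈ l, x ∈ A ∪ E) →
    l.IsChain (fun x y => ¬(x ∈ A ∧ y ∈ A) ∧ ¬(x ∈ E ∧ y ∈ E)) →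
    (hne : l ≠ []) → l.head hne ∈ E → l.head hne ∉ A →
    l.getLast hne ∈ A → l.getLast hne ∉ E → IsPairProduct A E l.prod := by
  induction n with
  | zero =>
    intro l hl _ _ hne
    exact absurd (List.length_eq_zero_iff.1 (Nat.le_zero.1 hl)) hne
  | succ n ih =>
    intro l hl hmem hch hne h1 h2 h3 h4
    match l, hl, hmem, hch, hne, h1, h2, h3, h4 with
    | [x], _, _, _, _, h1, _, _, h4 => exact absurd h1 h4
    | [e, a], _, _, _, _, h1, h2, h3, h4 =>
      rw [List.prod_cons, List.prod_singleton]
      exact .pair h1 h2 h3 h4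
    | e :: a :: b :: l, hl, hmem, hch, _, h1, h2, h3, h4 =>
      rw [List.isChain_cons_cons, List.isChain_cons_cons] at hch
      obtain ⟨hea, hab, hch⟩ := hch
      have haE : a ∉ E := fun h => hea.2 ⟨h1, h⟩
      have haA : a ∈ A := (hmem a (by simp)).resolve_right haE
      have hbA : b ∉ A := fun h => hab.1 ⟨haA, h⟩
      have hbE : b ∈ E := (hmem b (by simp)).resolve_left hbA
      rw [List.prod_cons, List.prod_cons, ← mul_assoc]
      refine .cons h1 h2 haA haE (ih (b :: l) ?_ (fun x hx => hmem x ?_) hch (by simp) hbE hbA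
        ?_ ?_)
      · simp at hl ⊢
        omega
      · simp at hx ⊢
        tauto
      · simpa using h3
      · simpa using h4

theorem isConj_mul_comm (x y : G) : IsConj (x * y) (y * x) :=
  isConj_iff.2 ⟨y, by group⟩

/-- Neighbouring letters in a common factor, also across the two ends up to conjugation, are merged,
which shortens the word. A word of length at least two that admits no merging alternates cyclically,
and at most one rotation makes it begin in `E` and end in `A`. -/
theorem exists_isConj_mem_or_isPairProduct (hA1 : (1 : G) ∈ A)
    (hA : ∀ x ∈ A, ∀ y ∈ A, x * y ∈ A) (hE : ∀ x ∈ E, ∀ y ∈ E, x * y ∈ E) (n : ℕ) :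
    ∀ l : List G, l.length ≤ n → (∀ x ∈ l, x ∈ A ∪ E) →
    ∃ g, IsConj l.prod g ∧ (g ∈ A ∪ E ∨ IsPairProduct A E g) := by
  have hmerge : ∀ x y : G,
      ¬(¬(x ∈ A ∧ y ∈ A) ∧ ¬(x ∈ E ∧ y ∈ E)) → x * y ∈ A ∪ E := by
    intro x y h
    by_cases h' : x ∈ A ∧ y ∈ A
    · exact Or.inl (hA x h'.1 y h'.2)
    · have h'' : x ∈ E ∧ y ∈ E := by tauto
      exact Or.inr (hE x h''.1 y h''.2)
  induction n with
  | zero =>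
    intro l hl _
    rw [List.length_eq_zero_iff.1 (Nat.le_zero.1 hl)]
    exact ⟨1, IsConj.refl _, Or.inl (Or.inl hA1)⟩
  | succ n ih =>
    intro l hl hmem
    by_cases hch : l.IsChain (fun x y => ¬(x ∈ A ∧ y ∈ A) ∧ ¬(x ∈ E ∧ y ∈ E))
    · match l, hl, hmem, hch with
      | [], _, _, _ => exact ⟨1, IsConj.refl _, Or.inl (Or.inl hA1)⟩
      | [x], _, hmem, _ => exact ⟨_, IsConj.refl _, Or.inl (by simpa using hmem x)⟩
      | x :: y :: l, hl, hmem, hch =>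
        obtain ⟨l', z, hz⟩ := (y :: l).eq_nil_or_concat.resolve_left (by simp)
        rw [List.concat_eq_append] at hz
        rw [hz] at hl hmem hch ⊢
        by_cases hzx : ¬(z ∈ A ∧ x ∈ A) ∧ ¬(z ∈ E ∧ x ∈ E)
        · rcases hmem x (by simp) with hx | hx
          · have hzA : z ∉ A := fun h => hzx.1 ⟨h, hx⟩
            have hzE : z ∈ E := (hmem z (by simp)).resolve_left hzA
            have hxE : x ∉ E := fun h => hzx.2 ⟨hzE, h⟩
            -- The word runs from `A` to `E`; moving its last letter to the front makes it run from
            -- `E` to `A`.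
            refine ⟨(z :: x :: l').prod, ?_, Or.inr ?_⟩
            · have : (x :: (l' ++ [z])).prod = (x :: l').prod * z := by simp [mul_assoc]
              rw [this, List.prod_cons (a := z)]
              exact isConj_mul_comm _ _
            · have hlast : ∀ (l'' : List G) (w : G), l' = l'' ++ [w] → w ∈ A ∧ w ∉ E := by
                rintro l'' w rfl
                rw [List.append_assoc] at hch
                have := (List.isChain_split (c := w) (l₁ := x :: l'') (l₂ := [z])).1 hch
                have hwz := (List.isChain_cons_cons.1 this.2).1
                have hwE : w ∉ E := fun h => hwz.2 ⟨h, hzE⟩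
                exact ⟨(hmem w (by simp)).resolve_right hwE, hwE⟩
              refine isPairProduct_of_isChain _ _ le_rfl ?_ ?_ (by simp) hzE hzA ?_ ?_
              · intro w hw
                apply hmem
                simp at hw ⊢
                tauto
              · rw [List.isChain_cons_cons]
                refine ⟨hzx, ?_⟩
                have : x :: (l' ++ [z]) = (x :: l') ++ [z] := by simp
                rw [this] at hch
                exact hch.left_of_append
              all_goals
                rcases l'.eq_nil_or_concat with rfl | ⟨l'', w, rfl⟩
                · simpa
                · have := hlast l'' w (List.concat_eq_append ..)
                  simp [this]
          · have hzE : z ∉ E := fun h => hzx.2 ⟨h, hx⟩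
            have hzA : z ∈ A := (hmem z (by simp)).resolve_right hzE
            have hxA : x ∉ A := fun h => hzx.1 ⟨hzA, h⟩
            exact ⟨_, IsConj.refl _, Or.inr (isPairProduct_of_isChain _ _ le_rfl hmem hch
              (by simp) hx hxA (by simpa) (by simpa))⟩
        · obtain ⟨g, hg, hg'⟩ := ih ((z * x) :: l') (by simp at hl ⊢; omega) (by
            intro w hw
            rcases List.mem_cons.1 hw with rfl | hw
            · exact hmerge _ _ hzx
            · exact hmem w (by simp [hw]))
          refine ⟨g, IsConj.trans ?_ hg, hg'⟩
          have h1 : (x :: (l' ++ [z])).prod = (x * l'.prod) * z := by simp [mul_assoc]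
          rw [h1, List.prod_cons, mul_assoc z x]
          exact isConj_mul_comm _ _
    · obtain ⟨l₁, x, y, l₂, rfl, hxy⟩ : ∃ l₁ x y l₂, l = l₁ ++ x :: y :: l₂ ∧
          ¬(¬(x ∈ A ∧ y ∈ A) ∧ ¬(x ∈ E ∧ y ∈ E)) := by
        rw [List.isChain_iff_forall_rel_of_append_cons_cons] at hch
        push Not at hch
        obtain ⟨x, y, l₁, l₂, h, h'⟩ := hch
        exact ⟨l₁, x, y, l₂, h, by tauto⟩
      obtain ⟨g, hg, hg'⟩ := ih (l₁ ++ (x * y) :: l₂) (by simp at hl ⊢; omega) (by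
        intro w hw
        rcases List.mem_append.1 hw with hw | hw
        · exact hmem w (by simp [hw])
        · rcases List.mem_cons.1 hw with rfl | hw
          · exact hmerge _ _ hxy
          · exact hmem w (by simp [hw]))
      refine ⟨g, ?_, hg'⟩
      simpa [mul_assoc] using hg

end Words

/-! ### Degree growth under alternating products -/

namespace GA2

open PlanePolyMap

variable {K : Type*} [Field K]

theorem mul_mem_affine {g h : GA2 K} (hg : g ∈ affine K) (hh : h ∈ affine K) :
    g * h ∈ affine K := by
  obtain ⟨a, M, hM⟩ := hg
  obtain ⟨b, N, hN⟩ := hh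
  refine ⟨fun i => M.val i 0 * b 0 + M.val i 1 * b 1 + a i, M * N, fun i => ?_⟩
  simp [mul_coord, hM, hN, Fin.sum_univ_two, algebraMap_eq, Matrix.mul_apply]
  ring

theorem linear_mem_affine (M : GL (Fin 2) K) : linear M ∈ affine K :=
  ⟨0, M, fun i => by simp [linear_coord, Fin.sum_univ_two]⟩

theorem one_mem_affine : (1 : GA2 K) ∈ affine K := by
  simpa using linear_mem_affine (1 : GL (Fin 2) K)

theorem mul_mem_elementary {g h : GA2 K} (hg : g ∈ elementary K) (hh : h ∈ elementary K) :
    g * h ∈ elementary K := by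
  obtain ⟨α, β, v, P, hαβ, h0, h1⟩ := hg
  obtain ⟨α', β', v', P', hαβ', h0', h1'⟩ := hh
  refine ⟨α * α', β * β', β * v' + v, Polynomial.C α * P' +
    P.comp (Polynomial.C β' * Polynomial.X + Polynomial.C v'), ?_, ?_, ?_⟩
  · rw [mul_mul_mul_comm]
    exact mul_ne_zero hαβ hαβ'
  · simp [mul_coord, h0, h0', h1', algebraMap_eq, ← Polynomial.aeval_algHom_apply,
      Polynomial.aeval_comp]
    ring
  · simp [mul_coord, h1, h1', algebraMap_eq]
    ring

/-- Induction along Horner's scheme `P = P.divX * X + P(0)`: over a domain the product term has the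
larger degree, so the constant cannot affect it. -/
theorem totalDegree_polynomial_aeval {σ : Type*} {q : MvPolynomial σ K}
    (hq : 0 < q.totalDegree) (P : Polynomial K) :
    (Polynomial.aeval q P).totalDegree = P.natDegree * q.totalDegree := by
  have hq0 : q ≠ 0 := by
    rintro rfl
    simp at hq
  generalize hn : P.natDegree = n
  induction n generalizing P with
  | zero =>
    rw [Polynomial.eq_C_of_natDegree_eq_zero hn, Polynomial.aeval_C, algebraMap_eq, totalDegree_C,
      zero_mul]
  | succ n ih =>
    have hd : P.divX.natDegree = n := by
      rw [Polynomial.natDegree_divX_eq_natDegree_tsub_one, hn, Nat.add_sub_cancel]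
    have h0 : Polynomial.aeval q P.divX ≠ 0 := by
      intro h
      have h' := ih _ hd
      rw [h, totalDegree_zero, eq_comm, Nat.mul_eq_zero] at h'
      obtain rfl := h'.resolve_right hq.ne'
      rw [Polynomial.eq_C_of_natDegree_eq_zero hd, Polynomial.aeval_C, algebraMap_eq,
        C_eq_zero] at h
      rw [← P.divX_mul_X_add, Polynomial.eq_C_of_natDegree_eq_zero hd, h] at hn
      simp at hn
    have hm : (Polynomial.aeval q P.divX * q).totalDegree = (n + 1) * q.totalDegree := by
      rw [totalDegree_mul_of_isDomain h0 hq0, ih _ hd]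
      ring
    nth_rewrite 1 [← P.divX_mul_X_add]
    rw [map_add, map_mul, Polynomial.aeval_X, Polynomial.aeval_C, algebraMap_eq,
      totalDegree_add_eq_left_of_totalDegree_lt, hm]
    rw [hm, totalDegree_C]
    positivity

theorem totalDegree_C_mul_le {σ : Type*} (c : K) (p : MvPolynomial σ K) :
    (C c * p).totalDegree ≤ p.totalDegree := by
  rw [C_mul']
  exact totalDegree_smul_le c p

theorem totalDegree_C_mul_of_ne_zero {σ : Type*} {c : K} (hc : c ≠ 0) (p : MvPolynomial σ K) :
    (C c * p).totalDegree = p.totalDegree := by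
  refine (totalDegree_C_mul_le c p).antisymm ?_
  have h := totalDegree_C_mul_le c⁻¹ (C c * p)
  rwa [← mul_assoc, ← C_mul, inv_mul_cancel₀ hc, C_1, one_mul] at h

theorem totalDegree_add_C {σ : Type*} (p : MvPolynomial σ K) (c : K) :
    (p + C c).totalDegree = p.totalDegree := by
  refine le_antisymm ((totalDegree_add _ _).trans (by simp)) ?_
  have h := totalDegree_add (p + C c) (C (-c))
  rwa [map_neg, add_neg_cancel_right, totalDegree_neg, totalDegree_C, max_eq_left (Nat.zero_le _)]
    at h

/-- The maps `h = (h₀, h₁)` with `deg h₁ < deg h₀` are preserved by `e * a` for `e` elementary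
but not affine and `a` affine but not elementary, and `deg h₀` grows. -/
theorem totalDegree_coord_lt_of_mul {e a : GA2 K} (he : e ∈ elementary K) (he' : e ∉ affine K)
    (ha : a ∈ affine K) (ha' : a ∉ elementary K) {h : PlanePolyMap K}
    (hh : (h.coord 1).totalDegree < (h.coord 0).totalDegree) :
    (((e * a).val * h).coord 1).totalDegree < (((e * a).val * h).coord 0).totalDegree ∧
      (h.coord 0).totalDegree < (((e * a).val * h).coord 0).totalDegree := by
  obtain ⟨α, β, v, P, hαβ, h0, h1⟩ := he
  obtain ⟨b, M, hM⟩ := ha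
  simp only [Fin.sum_univ_two] at hM
  -- Non-affinity of `e` means `deg P ≥ 2`, and non-elementarity of `a` means that its second
  -- coordinate involves `x`. So `a` puts the dominant degree into the second coordinate, and `P`
  -- multiplies it.
  have hP : 2 ≤ P.natDegree := by
    by_contra hP
    apply he'
    have hdet : (Matrix.of ![![α, P.coeff 1], ![0, β]]).det ≠ 0 := by
      simpa [Matrix.det_fin_two] using hαβ
    refine ⟨![P.coeff 0, v], Matrix.GeneralLinearGroup.mkOfDetNeZero _ hdet, fun i => ?_⟩
    have hP' := congrArg (Polynomial.aeval (X 1 : MvPolynomial (Fin 2) K))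
      (Polynomial.eq_X_add_C_of_natDegree_le_one (p := P) (by omega))
    simp only [map_add, map_mul, Polynomial.aeval_X, Polynomial.aeval_C, algebraMap_eq] at hP'
    fin_cases i
    · simp [h0, hP', Matrix.GeneralLinearGroup.mkOfDetNeZero, add_assoc]
    · simp [h1, Matrix.GeneralLinearGroup.mkOfDetNeZero]
  have hM10 : M.val 1 0 ≠ 0 := by
    intro h10
    apply ha'
    have hd : M.val.det ≠ 0 := M.det_ne_zero
    rw [Matrix.det_fin_two, h10, mul_zero, sub_zero] at hd
    refine ⟨M.val 0 0, M.val 1 1, b 1, Polynomial.C (M.val 0 1) * Polynomial.X +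
      Polynomial.C (b 0), hd, ?_, ?_⟩
    · rw [hM]
      simp [algebraMap_eq, add_assoc]
    · rw [hM, h10]
      simp
  set k := a.val * h with hk
  have hk' : ∀ i, k.coord i = C (M.val i 0) * h.coord 0 + C (M.val i 1) * h.coord 1 + C (b i) := by
    intro i
    simp [hk, mul_coord, hM, algebraMap_eq]
  have hk1 : (k.coord 1).totalDegree = (h.coord 0).totalDegree := by
    rw [hk', totalDegree_add_C, totalDegree_add_eq_left_of_totalDegree_lt,
      totalDegree_C_mul_of_ne_zero hM10]
    rw [totalDegree_C_mul_of_ne_zero hM10]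
    exact (totalDegree_C_mul_le _ _).trans_lt hh
  have hk0 : (k.coord 0).totalDegree ≤ (h.coord 0).totalDegree := by
    rw [hk', totalDegree_add_C]
    refine (totalDegree_add _ _).trans (max_le (totalDegree_C_mul_le _ _) ?_)
    exact (totalDegree_C_mul_le _ _).trans hh.le
  have e1 : (((e * a).val * h).coord 1).totalDegree = (h.coord 0).totalDegree := by
    have : ((e * a).val * h).coord 1 = C β * k.coord 1 + C v := by
      rw [Units.val_mul, mul_assoc, ← hk]
      simp [mul_coord, h1, algebraMap_eq]
    rw [this, totalDegree_add_C, totalDegree_C_mul_of_ne_zero (right_ne_zero_of_mul hαβ), hk1]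
  have hlt : (h.coord 0).totalDegree < P.natDegree * (h.coord 0).totalDegree := by nlinarith
  have e0 : (((e * a).val * h).coord 0).totalDegree = P.natDegree * (h.coord 0).totalDegree := by
    have : ((e * a).val * h).coord 0 = C α * k.coord 0 + Polynomial.aeval (k.coord 1) P := by
      rw [Units.val_mul, mul_assoc, ← hk]
      simp [mul_coord, h0, algebraMap_eq, ← Polynomial.aeval_algHom_apply]
    have hd := totalDegree_polynomial_aeval (q := k.coord 1) (by omega) P
    rw [hk1] at hd
    rw [this, totalDegree_add_eq_right_of_totalDegree_lt, hd]
    rw [hd]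
    exact ((totalDegree_C_mul_le _ _).trans hk0).trans_lt hlt
  rw [e0, e1]
  exact ⟨hlt, hlt⟩

theorem totalDegree_coord_lt_of_isPairProduct {g : GA2 K}
    (hg : IsPairProduct (affine K) (elementary K) g) {h : PlanePolyMap K}
    (hh : (h.coord 1).totalDegree < (h.coord 0).totalDegree) :
    ((g.val * h).coord 1).totalDegree < ((g.val * h).coord 0).totalDegree ∧
      (h.coord 0).totalDegree < ((g.val * h).coord 0).totalDegree := by
  induction hg with
  | pair he he' ha ha' => exact totalDegree_coord_lt_of_mul he he' ha ha' hh
  | cons he he' ha ha' _ ih =>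
    have := totalDegree_coord_lt_of_mul he he' ha ha' ih.1
    rw [Units.val_mul _ (_ : GA2 K), mul_assoc]
    exact ⟨this.1, ih.2.trans this.2⟩

theorem sq_ne_one_of_isPairProduct {g : GA2 K}
    (hg : IsPairProduct (affine K) (elementary K) g) : g ^ 2 ≠ 1 := by
  intro hs
  -- Any polynomial map with the degree inequality serves as a test map; it need not be invertible.
  let h : PlanePolyMap K := ⟨![X 0, 0]⟩
  have hh : (h.coord 1).totalDegree < (h.coord 0).totalDegree := by simp [h]
  have h1 := totalDegree_coord_lt_of_isPairProduct hg hh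
  have h2 := totalDegree_coord_lt_of_isPairProduct hg h1.1
  rw [← mul_assoc, ← Units.val_mul, ← pow_two, hs, Units.val_one, one_mul] at h2
  exact lt_asymm h1.2 h2.2

end GA2

/-! ### Derivations acting on coefficients -/

section CoeffDerivation

variable {R B : Type*} [CommRing R] [CommRing B] [Algebra R B]

/-- The extension of a derivation of `B` to `B[t]` that acts on the coefficients. -/
def Derivation.onCoeffs (d : Derivation R B B) : Derivation R (Polynomial B) (Polynomial B) :=
  ((PolynomialModule.equivPolynomialSelf : PolynomialModule B B ≃ₗ[Polynomial B] _) :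
    PolynomialModule B B →ₗ[Polynomial B] Polynomial B).compDer d.mapCoeffs

theorem Derivation.coeff_onCoeffs (d : Derivation R B B) (p : Polynomial B) (n : ℕ) :
    (d.onCoeffs p).coeff n = d (p.coeff n) := rfl

theorem Derivation.onCoeffs_C (d : Derivation R B B) (b : B) :
    d.onCoeffs (Polynomial.C b) = Polynomial.C (d b) := by
  ext n
  rw [coeff_onCoeffs, Polynomial.coeff_C, Polynomial.coeff_C]
  split_ifs <;> simp

theorem Derivation.natDegree_onCoeffs_le (d : Derivation R B B) (p : Polynomial B) :
    (d.onCoeffs p).natDegree ≤ p.natDegree := by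
  rw [Polynomial.natDegree_le_iff_coeff_eq_zero]
  intro n hn
  rw [coeff_onCoeffs, Polynomial.coeff_eq_zero_of_natDegree_lt hn, map_zero]

end CoeffDerivation

/-! ### Rigidity of `x ^ m - c y ^ n` -/

section Rigidity

variable {K : Type*} [Field K]

local notation "B" => MvPolynomial (Fin 2) K

theorem natDegree_eq_zero_of_dvd_C {p : Polynomial B} {b : B} (hb : b ≠ 0)
    (h : p ∣ Polynomial.C b) : p.natDegree = 0 :=
  Nat.le_zero.1 <| (Polynomial.natDegree_le_of_dvd h (by simpa using hb)).trans (by simp)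

theorem natDegree_eq_of_sub_eq_C {p q : Polynomial B} {b : B}
    (h : p - q = Polynomial.C b) : p.natDegree = q.natDegree := by
  have hp : p = q + Polynomial.C b := by rw [← h]; ring
  rw [hp, Polynomial.natDegree_add_C]

/-- A common divisor divides the nonzero constant on the right of `h`, so it has degree 0 in `t`; it
then divides the constant terms `x` and `y`, which are non-associated primes. -/
theorem isRelPrime_of_pow_sub_pow {m n : ℕ} {c : K} (hm : m ≠ 0) (hn : n ≠ 0)
    (hu : (X 0 ^ m - C c * X 1 ^ n : B) ≠ 0) {ξ η : Polynomial B}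
    (hξ : ξ.coeff 0 = X 0) (hη : η.coeff 0 = X 1)
    (h : ξ ^ m - Polynomial.C (C c) * η ^ n = Polynomial.C (X 0 ^ m - C c * X 1 ^ n)) :
    IsRelPrime ξ η := by
  intro d hd1 hd2
  have hd : d ∣ Polynomial.C (X 0 ^ m - C c * X 1 ^ n : B) := by
    rw [← h]
    exact dvd_sub (dvd_pow hd1 hm) ((dvd_pow hd2 hn).mul_left _)
  obtain ⟨b, rfl⟩ := Polynomial.natDegree_eq_zero.1 (natDegree_eq_zero_of_dvd_C hu hd)
  rw [Polynomial.isUnit_C]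
  have h0 : b ∣ X 0 := hξ ▸ (Polynomial.C_dvd_iff_dvd_coeff _ _).1 hd1 0
  have h1 : b ∣ X 1 := hη ▸ (Polynomial.C_dvd_iff_dvd_coeff _ _).1 hd2 0
  have hp0 : Prime (X 0 : B) := MvPolynomial.X_prime
  have hp1 : Prime (X 1 : B) := MvPolynomial.X_prime
  rcases hp0.irreducible.dvd_iff.1 h0 with hb | hb
  · exact hb
  rcases hp1.irreducible.dvd_iff.1 h1 with hb' | hb'
  · exact hb'
  · exfalso
    have := (hb.trans hb'.symm).dvd
    rw [X_dvd_X] at this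
    simp at this

/-- A Mason–Stothers type argument: differentiating the relation along a derivation of the
coefficients that kills `x ^ m - c y ^ n` gives divisibilities between powers of `ξ`, `η` and the
derivatives, and these are incompatible with positive degrees in `t`. -/
theorem eq_C_of_pow_sub_pow {m n : ℕ} (hm : 2 ≤ m) (hn : 2 ≤ n) (hmn : m.Coprime n) {c : K}
    (hc : c ≠ 0) {ξ η : Polynomial B} (hξ : ξ.coeff 0 = X 0) (hη : η.coeff 0 = X 1)
    (h : ξ ^ m - Polynomial.C (C c) * η ^ n = Polynomial.C (X 0 ^ m - C c * X 1 ^ n)) :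
    ξ = Polynomial.C (X 0) ∧ η = Polynomial.C (X 1) := by
  have hdeg : m * ξ.natDegree = n * η.natDegree := by
    have := natDegree_eq_of_sub_eq_C h
    rwa [Polynomial.natDegree_C_mul (by simpa using hc), Polynomial.natDegree_pow,
      Polynomial.natDegree_pow] at this
  suffices hz : ξ.natDegree = 0 ∨ η.natDegree = 0 by
    have hz' : ξ.natDegree = 0 ∧ η.natDegree = 0 := by
      rcases hz with hz | hz
      · rw [hz, mul_zero, eq_comm, Nat.mul_eq_zero] at hdeg
        exact ⟨hz, hdeg.resolve_left (by omega)⟩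
      · rw [hz, mul_zero, Nat.mul_eq_zero] at hdeg
        exact ⟨hdeg.resolve_left (by omega), hz⟩
    rw [Polynomial.eq_C_of_natDegree_eq_zero hz'.1, Polynomial.eq_C_of_natDegree_eq_zero hz'.2,
      hξ, hη]
    exact ⟨rfl, rfl⟩
  have hder : ∀ d : Derivation K B B,
      Polynomial.C (C (m : K)) * ξ ^ (m - 1) * d.onCoeffs ξ -
        Polynomial.C (C (c * n)) * η ^ (n - 1) * d.onCoeffs η =
      Polynomial.C (C (m : K) * X 0 ^ (m - 1) * d (X 0) - C (c * n) * X 1 ^ (n - 1) * d (X 1)) := by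
    intro d
    have e := congrArg d.onCoeffs h
    rw [d.onCoeffs_C] at e
    simp only [map_sub, Derivation.leibniz, Derivation.leibniz_pow, Derivation.onCoeffs_C,
      smul_eq_mul, nsmul_eq_mul, derivation_C, map_zero, mul_zero, add_zero, map_mul, map_pow,
      map_natCast] at e ⊢
    linear_combination e
  have hX0 : (X 0 : B) ≠ 0 := X_ne_zero 0
  have hX1 : (X 1 : B) ≠ 0 := X_ne_zero 1
  have hp01 : pderiv (0 : Fin 2) (X 1 : B) = 0 := pderiv_X_of_ne (by decide)
  have hp10 : pderiv (1 : Fin 2) (X 0 : B) = 0 := pderiv_X_of_ne (by decide)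
  have hcast : (m : K) ≠ 0 ∨ (n : K) ≠ 0 := by
    by_contra! hcon
    have := (CharP.cast_eq_zero_iff K (ringChar K) m).1 hcon.1
    have h1 := Nat.dvd_gcd this ((CharP.cast_eq_zero_iff K (ringChar K) n).1 hcon.2)
    rw [hmn.gcd_eq_one, Nat.dvd_one] at h1
    exact CharP.ringChar_ne_one h1
  -- If the characteristic divides `m`, then `∂/∂y` alone exhibits `η` as a divisor of a nonzero
  -- constant; the case of `n` is symmetric. Coprimality excludes both at once.
  by_cases hm0 : (m : K) = 0
  · right
    have hn0 := hcast.resolve_left (not_not.2 hm0)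
    have e := hder (pderiv 1)
    rw [hm0, pderiv_X_self] at e
    refine natDegree_eq_zero_of_dvd_C (b := C (c * n) * X 1 ^ (n - 1)) ?_ ?_
    · exact mul_ne_zero (C_ne_zero.2 (mul_ne_zero hc hn0)) (pow_ne_zero _ hX1)
    · have e' : Polynomial.C (C (c * n) * X 1 ^ (n - 1)) =
          η ^ (n - 1) * (Polynomial.C (C (c * n)) * (pderiv 1).onCoeffs η) := by
        simp only [map_zero, zero_mul, zero_sub, map_neg, mul_one] at e
        linear_combination e
      rw [e']
      exact (dvd_pow_self η (by omega)).mul_right _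
  by_cases hn0 : (n : K) = 0
  · left
    have e := hder (pderiv 0)
    rw [hn0, pderiv_X_self] at e
    refine natDegree_eq_zero_of_dvd_C (b := C (m : K) * X 0 ^ (m - 1)) ?_ ?_
    · exact mul_ne_zero (C_ne_zero.2 hm0) (pow_ne_zero _ hX0)
    · have e' : Polynomial.C (C (m : K) * X 0 ^ (m - 1)) =
          ξ ^ (m - 1) * (Polynomial.C (C (m : K)) * (pderiv 0).onCoeffs ξ) := by
        simp only [map_zero, mul_zero, zero_mul, sub_zero, mul_one] at e
        linear_combination -e
      rw [e']
      exact (dvd_pow_self ξ (by omega)).mul_right _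
  have hcn : c * (n : K) ≠ 0 := mul_ne_zero hc hn0
  -- The Hamiltonian derivation of `x ^ m - c y ^ n`, up to sign, which annihilates that polynomial.
  set d : Derivation K B B :=
    (C (c * n) * X 1 ^ (n - 1) : B) • pderiv 0 + (C (m : K) * X 0 ^ (m - 1) : B) • pderiv 1 with hd
  have hdx : d (X 0) = C (c * n) * X 1 ^ (n - 1) := by
    simp [hd, hp10]
  have hdy : d (X 1) = C (m : K) * X 0 ^ (m - 1) := by
    simp [hd, hp01]
  have e := hder d
  rw [hdx, hdy, show (C (m : K) * X 0 ^ (m - 1) * (C (c * n) * X 1 ^ (n - 1)) -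
    C (c * n) * X 1 ^ (n - 1) * (C (m : K) * X 0 ^ (m - 1)) : B) = 0 by ring, map_zero,
    sub_eq_zero] at e
  have hu : (X 0 ^ m - C c * X 1 ^ n : B) ≠ 0 := by
    intro h0
    have := congrArg (eval ![1, 0]) h0
    simp [show n ≠ 0 by omega] at this
  have hrel := isRelPrime_of_pow_sub_pow (by omega) (by omega) hu hξ hη h
  have hξ0 : ξ ≠ 0 := by
    rintro rfl
    exact hX0 (by simpa using hξ.symm)
  have hη0 : η ≠ 0 := by
    rintro rfl
    exact hX1 (by simpa using hη.symm)
  have hdξ : d.onCoeffs ξ ≠ 0 := by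
    intro h0
    have := d.coeff_onCoeffs ξ 0
    rw [h0, hξ, hdx, Polynomial.coeff_zero] at this
    exact mul_ne_zero (C_ne_zero.2 (mul_ne_zero hc hn0)) (pow_ne_zero _ hX1) this.symm
  have hdη : d.onCoeffs η ≠ 0 := by
    intro h0
    have := d.coeff_onCoeffs η 0
    rw [h0, hη, hdy, Polynomial.coeff_zero] at this
    exact mul_ne_zero (C_ne_zero.2 hm0) (pow_ne_zero _ hX0) this.symm
  have hunit : ∀ a : K, a ≠ 0 → IsUnit (Polynomial.C (C a) : Polynomial B) := fun a ha =>
    ((isUnit_iff_ne_zero.2 ha).map C).map Polynomial.C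
  have d1 : ξ ^ (m - 1) ∣ d.onCoeffs η := by
    have : ξ ^ (m - 1) ∣ Polynomial.C (C (c * n)) * (η ^ (n - 1) * d.onCoeffs η) :=
      ⟨Polynomial.C (C (m : K)) * d.onCoeffs ξ, by linear_combination -e⟩
    rw [(hunit _ hcn).dvd_mul_left] at this
    exact hrel.pow.dvd_of_dvd_mul_left this
  have d2 : η ^ (n - 1) ∣ d.onCoeffs ξ := by
    have : η ^ (n - 1) ∣ Polynomial.C (C (m : K)) * (ξ ^ (m - 1) * d.onCoeffs ξ) :=
      ⟨Polynomial.C (C (c * n)) * d.onCoeffs η, by linear_combination e⟩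
    rw [(hunit _ hm0).dvd_mul_left] at this
    exact hrel.symm.pow.dvd_of_dvd_mul_left this
  have n1 := (Polynomial.natDegree_le_of_dvd d1 hdη).trans (d.natDegree_onCoeffs_le η)
  have n2 := (Polynomial.natDegree_le_of_dvd d2 hdξ).trans (d.natDegree_onCoeffs_le ξ)
  rw [Polynomial.natDegree_pow] at n1 n2
  -- With positive degrees, `(m - 1) deg ξ ≤ deg η` and `(n - 1) deg η ≤ deg ξ` force `m = n = 2`,
  -- against coprimality.
  by_contra! hcon
  obtain ⟨k, rfl⟩ : ∃ k, m = k + 2 := ⟨m - 2, by omega⟩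
  obtain ⟨l, rfl⟩ : ∃ l, n = l + 2 := ⟨n - 2, by omega⟩
  have p1 := Nat.pos_of_ne_zero hcon.1
  have p2 := Nat.pos_of_ne_zero hcon.2
  simp only [show k + 2 - 1 = k + 1 by omega, show l + 2 - 1 = l + 1 by omega] at n1 n2
  have hk : k = 0 := by
    by_contra hk
    have : 1 ≤ k := by omega
    nlinarith
  have hl : l = 0 := by
    by_contra hl
    have : 1 ≤ l := by omega
    nlinarith
  subst hk hl
  simp at hmn

end Rigidity

/-! ### Top weighted components of products and substitutions -/

section WeightedTop

variable {K : Type*} [Field K] {σ : Type*}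

/-- Weights bounded by `a` and `b` add up to `a + b` only when both bounds are attained. Weights are
rational because a slope is used as a weight later. -/
theorem weightedHomogeneousComponent_mul_of_le {w : σ → ℚ} {a b : ℚ} {p q : MvPolynomial σ K}
    (hp : ∀ d ∈ p.support, Finsupp.weight w d ≤ a) (hq : ∀ d ∈ q.support, Finsupp.weight w d ≤ b) :
    weightedHomogeneousComponent w (a + b) (p * q) =
      weightedHomogeneousComponent w a p * weightedHomogeneousComponent w b q := by
  classical
  ext d
  rw [coeff_weightedHomogeneousComponent, coeff_mul, coeff_mul]
  split_ifs with hd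
  · refine Finset.sum_congr rfl fun x hx => ?_
    rw [coeff_weightedHomogeneousComponent, coeff_weightedHomogeneousComponent]
    rw [Finset.HasAntidiagonal.mem_antidiagonal] at hx
    rw [← hx, map_add] at hd
    by_cases h1 : coeff x.1 p = 0
    · simp [h1]
    by_cases h2 : coeff x.2 q = 0
    · simp [h2]
    have h1' := hp _ (mem_support_iff.2 h1)
    have h2' := hq _ (mem_support_iff.2 h2)
    rw [if_pos (by linarith), if_pos (by linarith)]
  · refine (Finset.sum_eq_zero fun x hx => ?_).symm
    rw [coeff_weightedHomogeneousComponent, coeff_weightedHomogeneousComponent]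
    rw [Finset.HasAntidiagonal.mem_antidiagonal] at hx
    rw [← hx, map_add] at hd
    split_ifs with h1 h2
    · exact absurd (by rw [h1, h2]) hd
    all_goals simp

theorem weight_le_of_mem_support_mul {w : σ → ℚ} {a b : ℚ} {p q : MvPolynomial σ K}
    (hp : ∀ d ∈ p.support, Finsupp.weight w d ≤ a) (hq : ∀ d ∈ q.support, Finsupp.weight w d ≤ b) :
    ∀ d ∈ (p * q).support, Finsupp.weight w d ≤ a + b := by
  classical
  intro d hd
  obtain ⟨x, hx, y, hy, rfl⟩ := Finset.mem_add.1 (support_mul p q hd)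
  rw [map_add]
  exact add_le_add (hp x hx) (hq y hy)

theorem weight_le_and_component_pow {w : σ → ℚ} {a : ℚ} {p : MvPolynomial σ K}
    (hp : ∀ d ∈ p.support, Finsupp.weight w d ≤ a) (k : ℕ) :
    (∀ d ∈ (p ^ k).support, Finsupp.weight w d ≤ k * a) ∧
    weightedHomogeneousComponent w (k * a) (p ^ k) = weightedHomogeneousComponent w a p ^ k := by
  induction k with
  | zero =>
    have h1 : IsWeightedHomogeneous w (1 : MvPolynomial σ K) 0 := isWeightedHomogeneous_one K w
    refine ⟨fun d hd => ?_, ?_⟩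
    · rw [pow_zero] at hd
      simpa using (h1 (mem_support_iff.1 hd)).le
    · simpa using h1.weightedHomogeneousComponent_same
  | succ k ih =>
    rw [pow_succ, pow_succ, Nat.cast_succ, add_mul, one_mul]
    exact ⟨weight_le_of_mem_support_mul ih.1 hp,
      by rw [weightedHomogeneousComponent_mul_of_le ih.1 hp, ih.2]⟩

theorem weightedHomogeneousComponent_aeval {v : Fin 2 → ℚ} {w : σ → ℚ}
    {g : Fin 2 → MvPolynomial σ K} (hg : ∀ i, ∀ d ∈ (g i).support, Finsupp.weight w d ≤ v i)
    {f : MvPolynomial (Fin 2) K} {N : ℚ} (hf : ∀ d ∈ f.support, Finsupp.weight v d ≤ N) :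
    weightedHomogeneousComponent w N (aeval g f) =
      aeval (fun i => weightedHomogeneousComponent w (v i) (g i))
        (weightedHomogeneousComponent v N f) := by
  classical
  have hmon : ∀ (d : Fin 2 →₀ ℕ) (r : K),
      (∀ s ∈ (aeval g (monomial d r)).support, Finsupp.weight w s ≤ Finsupp.weight v d) ∧
      weightedHomogeneousComponent w (Finsupp.weight v d) (aeval g (monomial d r)) =
        aeval (fun i => weightedHomogeneousComponent w (v i) (g i)) (monomial d r) := by
    intro d r
    have h0 := weight_le_and_component_pow (hg 0) (d 0)
    have h1 := weight_le_and_component_pow (hg 1) (d 1)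
    have hw : Finsupp.weight v d = d 0 * v 0 + d 1 * v 1 := by
      rw [Finsupp.weight_apply, Finsupp.sum_fintype _ _ (by simp)]
      simp
    have hm : ∀ u : Fin 2 → MvPolynomial σ K,
        aeval u (monomial d r) = r • (u 0 ^ d 0 * u 1 ^ d 1) := by
      intro u
      rw [aeval_monomial, Finsupp.prod_fintype _ _ (by simp), Fin.prod_univ_two,
        Algebra.smul_def]
    rw [hm, hm, hw, map_smul, weightedHomogeneousComponent_mul_of_le h0.1 h1.1, h0.2, h1.2]
    exact ⟨fun s hs => weight_le_of_mem_support_mul h0.1 h1.1 s (support_smul hs), rfl⟩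
  have hsum : ∀ F : (MvPolynomial (Fin 2) K) →ₗ[K] MvPolynomial σ K,
      F f = ∑ d ∈ f.support, F (monomial d (coeff d f)) := by
    intro F
    conv_lhs => rw [f.as_sum]
    rw [map_sum]
  have e1 := hsum ((weightedHomogeneousComponent w N).comp (aeval g).toLinearMap)
  have e2 := hsum ((aeval (fun i => weightedHomogeneousComponent w (v i) (g i))).toLinearMap.comp
    (weightedHomogeneousComponent v N))
  simp only [LinearMap.comp_apply, AlgHom.toLinearMap_apply] at e1 e2
  rw [e1, e2]
  refine Finset.sum_congr rfl fun d hd => ?_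
  have hm := isWeightedHomogeneous_monomial v d (coeff d f) rfl
  rcases (hf d hd).lt_or_eq with hlt | heq
  · rw [hm.weightedHomogeneousComponent_ne _ hlt.ne', map_zero]
    ext s
    rw [coeff_weightedHomogeneousComponent, coeff_zero]
    split_ifs with hs
    · by_contra hne
      have := (hmon d (coeff d f)).1 s (mem_support_iff.2 hne)
      linarith
    · rfl
  · rw [← heq, (hmon d _).2, hm.weightedHomogeneousComponent_same]

end WeightedTop

/-! ### Leading forms and the factor `x ^ m - c y ^ n` -/

section LeadingForms

variable {K : Type*} [Field K]

theorem weight_fin_two (v : Fin 2 → ℚ) (d : Fin 2 →₀ ℕ) :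
    Finsupp.weight v d = d 0 * v 0 + d 1 * v 1 := by
  rw [Finsupp.weight_apply, Finsupp.sum_fintype _ _ (by simp)]
  simp

theorem weight_cons (θ : ℚ) (v : Fin 2 → ℚ) (d : Fin 3 →₀ ℕ) :
    Finsupp.weight (Fin.cons θ v : Fin 3 → ℚ) d = d 0 * θ + Finsupp.weight v d.tail := by
  rw [weight_fin_two, Finsupp.weight_apply, Finsupp.sum_fintype _ _ (by simp), Fin.sum_univ_three]
  simp only [nsmul_eq_mul, Finsupp.tail_apply, add_assoc]
  rfl

/-- Homogeneity and coprimality fix the `x`-exponents modulo `m`, so replacing `x ^ m` by `c y ^ n`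
reduces `F` to a single monomial. Its coefficient vanishes on evaluation at `(a, b)`, a zero of the
divisor with both entries nonzero. -/
theorem pow_sub_pow_dvd_of_eval_eq_zero {m n : ℕ} (hm : 0 < m) (hmn : m.Coprime n) {N : ℚ}
    {F : MvPolynomial (Fin 2) K} (hF : IsWeightedHomogeneous ![(n : ℚ), (m : ℚ)] F N)
    {a b : K} (ha : a ≠ 0) (hb : b ≠ 0) (h0 : eval ![a, b] F = 0) :
    X 0 ^ m - C (a ^ m / b ^ n) * X 1 ^ n ∣ F := by
  set c := a ^ m / b ^ n with hc
  set u : MvPolynomial (Fin 2) K := X 0 ^ m - C c * X 1 ^ n with hu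
  by_cases hF0 : F = 0
  · simp [hF0]
  obtain ⟨e, he⟩ := ne_zero_iff.1 hF0
  have hexp : ∀ d ∈ F.support, d 0 % m = e 0 % m ∧
      d 1 + n * (d 0 / m) = e 1 + n * (e 0 / m) := by
    intro d hd
    have h1 := hF (mem_support_iff.1 hd)
    have h2 := hF he
    rw [weight_fin_two] at h1 h2
    simp only [Matrix.cons_val_zero, Matrix.cons_val_one] at h1 h2
    have h3 : d 0 * n + d 1 * m = e 0 * n + e 1 * m := by
      have : (d 0 * n + d 1 * m : ℚ) = e 0 * n + e 1 * m := by rw [h1, h2]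
      exact_mod_cast this
    have h4 : d 0 ≡ e 0 [MOD m] := by
      apply Nat.ModEq.cancel_right_of_coprime (c := n) hmn
      have : d 0 * n + d 1 * m ≡ e 0 * n + e 1 * m [MOD m] := by rw [h3]
      simpa [Nat.ModEq, Nat.add_mul_mod_self_right] using this
    refine ⟨h4, ?_⟩
    have h5 := Nat.mod_add_div (d 0) m
    have h6 := Nat.mod_add_div (e 0) m
    rw [show d 0 % m = e 0 % m from h4] at h5
    refine Nat.eq_of_mul_eq_mul_left hm ?_
    zify at h3 h5 h6 ⊢
    linear_combination h3 + n * h5 - n * h6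
  have hmon : ∀ d ∈ F.support, u ∣ monomial d (coeff d F) -
      C (coeff d F * c ^ (d 0 / m)) * (X 0 ^ (e 0 % m) * X 1 ^ (e 1 + n * (e 0 / m))) := by
    intro d hd
    obtain ⟨h1, h2⟩ := hexp d hd
    rw [← h1, ← h2]
    have h3 : u ∣ (X 0 ^ m) ^ (d 0 / m) - (C c * X 1 ^ n) ^ (d 0 / m) := sub_dvd_pow_sub_pow _ _ _
    have h4 : (X 0 : MvPolynomial (Fin 2) K) ^ d 0 = X 0 ^ (d 0 % m) * (X 0 ^ m) ^ (d 0 / m) := by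
      rw [← pow_mul, ← pow_add, Nat.mod_add_div]
    have h5 : monomial d (coeff d F) = C (coeff d F) * (X 0 ^ d 0 * X 1 ^ d 1) := by
      rw [monomial_eq, Finsupp.prod_fintype _ _ (by simp), Fin.prod_univ_two]
    rw [h5, h4]
    convert h3.mul_left (C (coeff d F) * X 0 ^ (d 0 % m) * X 1 ^ d 1) using 1
    rw [mul_pow, C_mul, C_pow, pow_add, pow_mul]
    ring
  set κ := ∑ d ∈ F.support, coeff d F * c ^ (d 0 / m) with hκ
  have hdvd : u ∣ F - C κ * (X 0 ^ (e 0 % m) * X 1 ^ (e 1 + n * (e 0 / m))) := by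
    have := Finset.dvd_sum hmon
    rwa [Finset.sum_sub_distrib, ← F.as_sum, ← Finset.sum_mul, ← map_sum] at this
  have hue : eval ![a, b] u = 0 := by
    simp [hu, hc, hb]
  have hκ0 : κ = 0 := by
    obtain ⟨r, hr⟩ := hdvd
    have := congrArg (eval ![a, b]) hr
    simpa [h0, hue, ha, hb] using this
  simpa [hκ0] using hdvd

theorem coeff_aeval_eq_eval_component {m n k N : ℕ} {P Q : Polynomial K}
    (hP : P.natDegree ≤ k * n) (hQ : Q.natDegree ≤ k * m) {f : MvPolynomial (Fin 2) K}
    (hf : ∀ d ∈ f.support, d 0 * n + d 1 * m ≤ N) (hk : 0 < k) :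
    (aeval ![P, Q] f).coeff (k * N) =
      eval ![P.coeff (k * n), Q.coeff (k * m)]
        (weightedHomogeneousComponent ![(n : ℚ), (m : ℚ)] (N : ℚ) f) := by
  classical
  have e1 : (aeval ![P, Q] f).coeff (k * N) =
      ∑ d ∈ f.support, coeff d f * (P ^ d 0 * Q ^ d 1).coeff (k * N) := by
    rw [aeval_def, eval₂_eq', Polynomial.finsetSum_coeff]
    simp [Fin.prod_univ_two]
  rw [e1, weightedHomogeneousComponent_apply, map_sum]
  rw [Finset.sum_filter]
  refine Finset.sum_congr rfl fun d hd => ?_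
  have hPd : (P ^ d 0).natDegree ≤ d 0 * (k * n) := Polynomial.natDegree_pow_le_of_le _ hP
  have hQd : (Q ^ d 1).natDegree ≤ d 1 * (k * m) := Polynomial.natDegree_pow_le_of_le _ hQ
  have hw : Finsupp.weight ![(n : ℚ), (m : ℚ)] d = N ↔ d 0 * n + d 1 * m = N := by
    rw [weight_fin_two]
    simp only [Matrix.cons_val_zero, Matrix.cons_val_one]
    exact_mod_cast Iff.rfl
  simp only [hw]
  split_ifs with h
  · rw [show k * N = d 0 * (k * n) + d 1 * (k * m) by rw [← h]; ring,
      Polynomial.coeff_mul_add_eq_of_natDegree_le hPd hQd, Polynomial.coeff_pow_of_natDegree_le hP,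
      Polynomial.coeff_pow_of_natDegree_le hQ, eval_monomial,
      Finsupp.prod_fintype _ _ (by simp), Fin.prod_univ_two]
    simp
  · rw [Polynomial.coeff_eq_zero_of_natDegree_lt, mul_zero]
    refine (Polynomial.natDegree_mul_le_of_le hPd hQd).trans_lt ?_
    have h' : d 0 * n + d 1 * m < N := lt_of_le_of_ne (hf d hd) h
    calc d 0 * (k * n) + d 1 * (k * m) = k * (d 0 * n + d 1 * m) := by ring
      _ < k * N := Nat.mul_lt_mul_of_pos_left h' hk

/-- For an automorphism with inverse `f`, the leading form of `f 0` with respect to the weights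
`(n, m)` has no factor `x ^ m - c y ^ n` when `m, n ≥ 2` are coprime: otherwise the top part of the
additive group action `f 0 ↦ f 0`, `f 1 ↦ f 1 + t` would violate rigidity. -/
theorem not_pow_sub_pow_dvd_component {p f : Fin 2 → MvPolynomial (Fin 2) K}
    (hpf : ∀ i, aeval p (f i) = X i) (hfp : ∀ i, aeval f (p i) = X i) {m n : ℕ} (hm : 2 ≤ m)
    (hn : 2 ≤ n) (hmn : m.Coprime n) {c : K} (hc : c ≠ 0) {v : Fin 2 → ℚ} {N : ℚ}
    (hN : ∀ d ∈ (f 0).support, Finsupp.weight v d ≤ N)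
    (hne : weightedHomogeneousComponent v N (f 0) ≠ 0) :
    ¬ X 0 ^ m - C c * X 1 ^ n ∣ weightedHomogeneousComponent v N (f 0) := by
  classical
  intro hdvd
  -- Variable 0 is the time `t`. The `x i` are the components of the translation flow `(f 0, f 1 +
  -- t)` transported by the automorphism; at `t = 0` they reduce to the coordinates.
  set F : Fin 2 → MvPolynomial (Fin 3) K :=
    ![rename Fin.succ (f 0), rename Fin.succ (f 1) + X 0] with hF
  set x : Fin 2 → MvPolynomial (Fin 3) K := fun i => aeval F (p i) with hx
  have hxf : ∀ i, aeval x (f i) = F i := by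
    intro i
    have : aeval x (f i) = aeval F (aeval p (f i)) := by
      rw [← AlgHom.comp_apply, comp_aeval]
    rw [this, hpf, aeval_X]
  let E := finSuccEquiv K 2
  have hEr : ∀ h : MvPolynomial (Fin 2) K, E (rename Fin.succ h) = Polynomial.C h := by
    intro h
    induction h using MvPolynomial.induction_on with
    | C a => simp [E, finSuccEquiv_apply]
    | add p q hp hq => rw [map_add, map_add, hp, hq, map_add]
    | mul_X p i hp => rw [map_mul, map_mul, hp, rename_X, finSuccEquiv_X_succ, map_mul]
  have hcoeff : ∀ (h : MvPolynomial (Fin 3) K) (d : Fin 3 →₀ ℕ),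
      coeff d h = coeff d.tail ((E h).coeff (d 0)) := by
    intro h d
    rw [finSuccEquiv_coeff_coeff, Finsupp.cons_tail]
  have hx0 : ∀ i, (E (x i)).coeff 0 = X i := by
    intro i
    let ψ : MvPolynomial (Fin 3) K →ₐ[K] MvPolynomial (Fin 2) K :=
      ((Polynomial.aeval (0 : MvPolynomial (Fin 2) K)).restrictScalars K).comp E.toAlgHom
    have hψ : ∀ h, ψ h = (E h).coeff 0 := fun h => Polynomial.coeff_zero_eq_aeval_zero _ |>.symm
    have hψF : (fun j => ψ (F j)) = f := by
      funext j
      rw [hψ]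
      fin_cases j
      · simp [hF, hEr]
      · simp [hF, hEr, E, finSuccEquiv_X_zero]
    rw [← hψ, hx]
    change ψ (aeval F (p i)) = X i
    rw [← AlgHom.comp_apply, comp_aeval, hψF, hfp]
  have hsupp : ∀ i, ∀ d ∈ (x i - X i.succ).support, 0 < d 0 := by
    intro i d hd
    rw [mem_support_iff, hcoeff] at hd
    by_contra h0
    rw [Nat.eq_zero_of_not_pos h0] at hd
    apply hd
    simp [hx0, E, finSuccEquiv_X_succ]
  set S : Finset (Σ _ : Fin 2, Fin 3 →₀ ℕ) :=
    Finset.univ.sigma fun i => (x i - X i.succ).support with hS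
  have hSne : S.Nonempty := by
    by_contra hSe
    rw [Finset.not_nonempty_iff_eq_empty] at hSe
    have hxX : x = fun i => X i.succ := by
      funext i
      rw [← sub_eq_zero, ← support_eq_empty]
      refine Finset.eq_empty_of_forall_notMem fun d hd => ?_
      have : (⟨i, d⟩ : Σ _ : Fin 2, Fin 3 →₀ ℕ) ∈ S := by simpa [hS] using hd
      rw [hSe] at this
      simp at this
    have h1 := hxf 1
    have h2 : aeval x (f 1) = rename Fin.succ (f 1) := by
      rw [hxX, rename_eq_aeval]
      rfl
    rw [h2] at h1
    simp [hF] at h1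
  obtain ⟨⟨i₀, d₀⟩, hmem₀, hmin⟩ := S.exists_min_image
    (fun s => (v s.1 - Finsupp.weight v s.2.tail) / s.2 0) hSne
  -- The largest weight of `t` for which no term of `x i` exceeds weight `v i`. The minimum is
  -- attained at `d₀`, so the leading part of the flow still involves `t`.
  set θ : ℚ := (v i₀ - Finsupp.weight v d₀.tail) / d₀ 0 with hθ
  have hd₀ : d₀ ∈ (x i₀ - X i₀.succ).support := by simpa [hS] using hmem₀
  set w : Fin 3 → ℚ := Fin.cons θ v with hw
  have hwX : ∀ i : Fin 2, Finsupp.weight w (Finsupp.single i.succ 1) = v i := by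
    intro i
    simp [hw, Finsupp.weight_single]
  have hle : ∀ i, ∀ d ∈ (x i).support, Finsupp.weight w d ≤ v i := by
    intro i d hd
    by_cases hd' : d ∈ (x i - X i.succ).support
    · have h1 := hmin ⟨i, d⟩ (by simpa [hS] using hd')
      have h2 : (0 : ℚ) < d 0 := by exact_mod_cast hsupp i d hd'
      simp only at h1
      rw [le_div_iff₀ h2] at h1
      rw [hw, weight_cons]
      linarith
    · rw [notMem_support_iff, coeff_sub, sub_eq_zero] at hd'
      rw [mem_support_iff, hd', coeff_X] at hd
      have : Finsupp.single i.succ 1 = d := by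
        by_contra hcon
        simp [hcon] at hd
      rw [← this, hwX]
  have heq : Finsupp.weight w d₀ = v i₀ := by
    have h2 : (d₀ 0 : ℚ) ≠ 0 := by exact_mod_cast (hsupp i₀ d₀ hd₀).ne'
    rw [hw, weight_cons, hθ]
    field_simp
    ring
  set ξ : Fin 2 → MvPolynomial (Fin 3) K :=
    fun i => weightedHomogeneousComponent w (v i) (x i) with hξ
  have hξ0 : ∀ i, (E (ξ i)).coeff 0 = X i := by
    intro i
    ext s
    rw [finSuccEquiv_coeff_coeff, hξ, coeff_weightedHomogeneousComponent,
      ← finSuccEquiv_coeff_coeff]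
    change (if _ then coeff s ((E (x i)).coeff 0) else 0) = _
    rw [hx0, coeff_X]
    split_ifs with h1 h2 h2
    · rfl
    · rfl
    · exfalso
      apply h1
      rw [hw, weight_cons, ← h2]
      simp [Finsupp.weight_single]
    · rfl
  have htop : aeval ξ (weightedHomogeneousComponent v N (f 0)) =
      rename Fin.succ (weightedHomogeneousComponent v N (f 0)) := by
    have h1 := weightedHomogeneousComponent_aeval hle hN
    rw [hxf] at h1
    have h2 := weightedHomogeneousComponent_aeval (v := v) (w := w)
      (g := fun i : Fin 2 => (X i.succ : MvPolynomial (Fin 3) K)) (fun i d hd => by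
        rw [mem_support_iff, coeff_X] at hd
        have : Finsupp.single i.succ 1 = d := by
          by_contra hcon
          simp [hcon] at hd
        rw [← this, hwX]) hN
    have h3 : ∀ h : MvPolynomial (Fin 2) K,
        aeval (fun i : Fin 2 => (X i.succ : MvPolynomial (Fin 3) K)) h = rename Fin.succ h := by
      intro h
      rw [rename_eq_aeval]
      rfl
    have h4 : ∀ i : Fin 2, weightedHomogeneousComponent w (v i)
        (X i.succ : MvPolynomial (Fin 3) K) = X i.succ := by
      intro i
      have := isWeightedHomogeneous_X K w i.succ
      rw [show w i.succ = v i by simp [hw]] at this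
      exact this.weightedHomogeneousComponent_same
    simp only [h4, h3] at h2
    rw [← h1, ← h2]
    rfl
  -- The leading form of `f 0` is invariant under the leading flow `ξ`, hence free of `t`. So is the
  -- image of its factor, which therefore equals its value at `t = 0`.
  have hdvd' : E (aeval ξ (X 0 ^ m - C c * X 1 ^ n)) ∣
      Polynomial.C (weightedHomogeneousComponent v N (f 0)) := by
    rw [← hEr, ← htop]
    exact map_dvd E (map_dvd (aeval ξ) hdvd)
  have hu : E (aeval ξ (X 0 ^ m - C c * X 1 ^ n)) =
      E (ξ 0) ^ m - Polynomial.C (C c) * E (ξ 1) ^ n := by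
    have : E (C c) = Polynomial.C (C c) := by
      rw [← hEr, rename_C]
    simp [algebraMap_eq, this]
  have hdeg := natDegree_eq_zero_of_dvd_C hne hdvd'
  rw [hu] at hdeg
  have hrel : E (ξ 0) ^ m - Polynomial.C (C c) * E (ξ 1) ^ n =
      Polynomial.C (X 0 ^ m - C c * X 1 ^ n) := by
    rw [Polynomial.eq_C_of_natDegree_eq_zero hdeg]
    simp only [Polynomial.coeff_zero_eq_eval_zero] at hξ0 ⊢
    simp only [Polynomial.eval_sub, Polynomial.eval_mul, Polynomial.eval_pow, Polynomial.eval_C,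
      hξ0]
  obtain ⟨r0, r1⟩ := eq_C_of_pow_sub_pow hm hn hmn hc (hξ0 0) (hξ0 1) hrel
  have hr : ∀ i, E (ξ i) = Polynomial.C (X i) := by
    intro i
    fin_cases i
    exacts [r0, r1]
  have hpos := hsupp i₀ d₀ hd₀
  have hcd : coeff d₀ (ξ i₀) = coeff d₀ (x i₀) := by
    rw [hξ, coeff_weightedHomogeneousComponent, if_pos heq]
  rw [hcoeff, hr, Polynomial.coeff_C, if_neg hpos.ne', coeff_zero] at hcd
  rw [mem_support_iff, coeff_sub, ← hcd, hcoeff _ d₀] at hd₀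
  apply hd₀
  simp [E, finSuccEquiv_X_succ, Polynomial.coeff_C, hpos.ne']

end LeadingForms

/-! ### Generation by affine and elementary maps -/

namespace GA2

open PlanePolyMap

variable {K : Type*} [Field K]

theorem aeval_coord_inv (σ : GA2 K) (i : Fin 2) :
    aeval σ.val.coord (σ⁻¹.val.coord i) = X i := by
  rw [← mul_coord, Units.inv_mul, one_coord]

theorem aeval_inv_coord (σ : GA2 K) (i : Fin 2) :
    aeval σ⁻¹.val.coord (σ.val.coord i) = X i := by
  rw [← mul_coord, Units.mul_inv, one_coord]

/-- Over `K[y]`, the first coordinate is a polynomial in `x` with a left inverse under composition;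
degrees multiply, so it is linear in `x`, and its leading coefficient is a unit of `K[y]`, that is,
a nonzero scalar. -/
theorem mem_elementary_of_coord_one {σ : GA2 K} {β v : K} (hβ : β ≠ 0)
    (h1 : σ.val.coord 1 = C β * X 1 + C v) : σ ∈ elementary K := by
  let θ : MvPolynomial (Fin 2) K →ₐ[K] Polynomial (Polynomial K) :=
    aeval ![Polynomial.X, Polynomial.C Polynomial.X]
  let ψ : Polynomial (Polynomial K) →+* MvPolynomial (Fin 2) K :=
    Polynomial.eval₂RingHom (Polynomial.aeval (X 1 : MvPolynomial (Fin 2) K)).toRingHom (X 0)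
  have hψθ : ∀ q, ψ (θ q) = q := by
    intro q
    have : ψ.comp θ.toRingHom = RingHom.id _ := by
      apply MvPolynomial.ringHom_ext
      · intro a
        simp [ψ, θ, Polynomial.algebraMap_apply, algebraMap_eq]
      · intro i
        fin_cases i <;> simp [ψ, θ]
    exact RingHom.congr_fun this q
  set q := σ.val.coord 0 with hq
  let F : Polynomial (Polynomial K) := aeval ![Polynomial.X, θ (C β * X 1 + C v)] (σ⁻¹.val.coord 0)
  have hθ1 : θ (C β * X 1 + C v) =
      Polynomial.C (Polynomial.C β * Polynomial.X + Polynomial.C v) := by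
    simp [θ, Polynomial.algebraMap_apply]
  have hF : F.comp (θ q) = Polynomial.X := by
    have e1 : F.comp (θ q) = ((Polynomial.aeval (θ q)).restrictScalars K) F := rfl
    have e2 : (fun i => ((Polynomial.aeval (R := Polynomial K) (θ q)).restrictScalars K)
        ((![Polynomial.X, θ (C β * X 1 + C v)] : Fin 2 → Polynomial (Polynomial K)) i)) =
        fun i => θ (σ.val.coord i) := by
      funext i
      fin_cases i
      · simp [hq]
      · simp only [Fin.mk_one, h1, Matrix.cons_val_one, hθ1]
        simp
    rw [e1, ← AlgHom.comp_apply, comp_aeval, e2, ← comp_aeval, AlgHom.comp_apply,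
      aeval_coord_inv]
    simp [θ]
  have hdeg : F.natDegree * (θ q).natDegree = 1 := by
    rw [← Polynomial.natDegree_comp, hF, Polynomial.natDegree_X]
  have hd1 := Nat.eq_one_of_mul_eq_one_right hdeg
  have hd2 := Nat.eq_one_of_mul_eq_one_left hdeg
  have hlead : F.leadingCoeff * (θ q).leadingCoeff = 1 := by
    have := Polynomial.leadingCoeff_comp (p := F) (q := θ q) (by omega)
    rw [hF, Polynomial.leadingCoeff_X, hd1, pow_one] at this
    exact this.symm
  obtain ⟨α, hα, hα'⟩ := Polynomial.isUnit_iff.1 (IsUnit.of_mul_eq_one_right _ hlead)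
  refine ⟨α, β, v, (θ q).coeff 0, mul_ne_zero hα.ne_zero hβ, ?_, h1⟩
  have hlin := Polynomial.eq_X_add_C_of_natDegree_le_one hd2.le
  rw [Polynomial.leadingCoeff, hd2] at hα'
  rw [← hα'] at hlin
  have hψ := hψθ q
  rw [hlin] at hψ
  rw [← hq]
  refine hψ.symm.trans ?_
  simp [ψ, algebraMap_eq]

/-- The restriction of the coordinates of `σ` to the line `y = 0`. -/
def axis (σ : GA2 K) (i : Fin 2) : Polynomial K :=
  aeval ![Polynomial.X, 0] (σ.val.coord i)

theorem axis_mul (τ σ : GA2 K) (i : Fin 2) :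
    axis (τ * σ) i = aeval (axis σ) (τ.val.coord i) := by
  rw [axis, Units.val_mul, mul_coord, ← AlgHom.comp_apply, comp_aeval]
  rfl

theorem matT_coord_zero : (linear (matT K)).val.coord 0 = X 1 := by
  simp [linear_coord, matT]

theorem matT_coord_one : (linear (matT K)).val.coord 1 = X 0 := by
  simp [linear_coord, matT]

theorem linear_matT_mul_self : linear (matT K) * linear (matT K) = 1 := by
  ext1
  apply ext_coord <;>
    simp [Units.val_mul, mul_coord, matT_coord_zero, matT_coord_one, one_coord]

theorem axis_swap_mul_zero (σ : GA2 K) : axis (linear (matT K) * σ) 0 = axis σ 1 := by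
  simp [axis_mul, matT_coord_zero]

theorem axis_swap_mul_one (σ : GA2 K) : axis (linear (matT K) * σ) 1 = axis σ 0 := by
  simp [axis_mul, matT_coord_one]

theorem X_one_dvd_sub_aeval_axis (p : MvPolynomial (Fin 2) K) :
    X 1 ∣ p - Polynomial.aeval (X 0) (aeval ![Polynomial.X, (0 : Polynomial K)] p) := by
  set I : Ideal (MvPolynomial (Fin 2) K) := Ideal.span {X 1} with hI
  have h1 : Ideal.Quotient.mkₐ K I (X 1) = 0 :=
    Ideal.Quotient.eq_zero_iff_mem.2 (Ideal.mem_span_singleton_self _)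
  have : Ideal.Quotient.mkₐ K I = (Ideal.Quotient.mkₐ K I).comp
      ((Polynomial.aeval (X 0)).comp (aeval ![Polynomial.X, (0 : Polynomial K)])) := by
    apply MvPolynomial.algHom_ext
    intro i
    fin_cases i
    · simp
    · simpa using h1
  have h2 := AlgHom.congr_fun this p
  rw [← Ideal.mem_span_singleton, ← hI, ← Ideal.Quotient.eq]
  exact h2

/-- Here `y` divides `σ₀ - e`. Applying the inverse turns this into a factorisation of `x - e`, of
degree 1, with a nonconstant factor, so the cofactor is a scalar. -/
theorem coord_zero_of_axis_zero_eq_C {σ : GA2 K} {e : K} (h : axis σ 0 = Polynomial.C e) :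
    ∃ b : K, b ≠ 0 ∧ σ.val.coord 0 = C b * X 1 + C e := by
  obtain ⟨r, hr⟩ := X_one_dvd_sub_aeval_axis (σ.val.coord 0)
  rw [show aeval ![Polynomial.X, (0 : Polynomial K)] (σ.val.coord 0) = axis σ 0 from rfl, h,
    Polynomial.aeval_C, algebraMap_eq] at hr
  have h1 := congrArg (aeval σ⁻¹.val.coord) hr
  rw [map_sub, map_mul, aeval_inv_coord, aeval_C, algebraMap_eq, aeval_X] at h1
  set s := aeval σ⁻¹.val.coord r with hs
  have hdX : (X 0 - C e : MvPolynomial (Fin 2) K).totalDegree = 1 := by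
    rw [sub_eq_add_neg, ← map_neg, totalDegree_add_C, totalDegree_X]
  have hne : (X 0 - C e : MvPolynomial (Fin 2) K) ≠ 0 := by
    intro h0
    rw [h0, totalDegree_zero] at hdX
    omega
  rw [h1] at hne
  have hg : (σ⁻¹.val.coord 1).totalDegree ≠ 0 := by
    intro h0
    rw [totalDegree_eq_zero_iff_eq_C] at h0
    have h2 := aeval_coord_inv σ 1
    rw [h0, aeval_C, algebraMap_eq] at h2
    have h3 := congrArg totalDegree h2
    rw [totalDegree_C, totalDegree_X] at h3
    omega
  have hd := totalDegree_mul_of_isDomain (left_ne_zero_of_mul hne) (right_ne_zero_of_mul hne)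
  rw [← h1, hdX] at hd
  have hs0 := totalDegree_eq_zero_iff_eq_C.1 (show s.totalDegree = 0 by omega)
  have hr' : r = aeval σ.val.coord s := by
    rw [hs, ← AlgHom.comp_apply, comp_aeval]
    simp only [aeval_coord_inv]
    exact (aeval_X_left_apply r).symm
  rw [hs0, aeval_C, algebraMap_eq] at hr'
  refine ⟨coeff 0 s, ?_, ?_⟩
  · intro h0
    rw [h0, map_zero] at hs0
    exact right_ne_zero_of_mul hne hs0
  · rw [hr'] at hr
    linear_combination hr

theorem shear_mem_elementary (P : Polynomial K) : shear P ∈ elementary K :=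
  ⟨1, 1, 0, P, by simp, by simp [shear_coord_zero], by simp [shear_coord_one]⟩

theorem inv_shear_mem_elementary (P : Polynomial K) : (shear P)⁻¹ ∈ elementary K := by
  have : (shear P)⁻¹ = shear (-P) := by
    ext1
    apply ext_coord
    · rw [shear_coord_zero, map_neg, ← sub_eq_add_neg]
      rfl
    · rfl
  rw [this]
  exact shear_mem_elementary _

/-- The Euclidean step: a multiple of a power of the second restriction cancels the leading term of
the first. -/
theorem exists_shear_natDegree_lt {σ : GA2 K} (h0 : 0 < (axis σ 0).natDegree)
    (hdvd : (axis σ 1).natDegree ∣ (axis σ 0).natDegree) :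
    ∃ P : Polynomial K, (axis (shear P * σ) 0).natDegree + (axis (shear P * σ) 1).natDegree <
      (axis σ 0).natDegree + (axis σ 1).natDegree := by
  obtain ⟨k, hk⟩ := hdvd
  have hne : axis σ 0 ≠ 0 := fun h => by simp [h] at h0
  have hne1 : axis σ 1 ≠ 0 := fun h => by
    rw [h, Polynomial.natDegree_zero, zero_mul] at hk
    omega
  set c := (axis σ 0).leadingCoeff / (axis σ 1).leadingCoeff ^ k with hc
  have hl1 : (axis σ 1).leadingCoeff ≠ 0 := Polynomial.leadingCoeff_ne_zero.2 hne1
  have hc0 : c ≠ 0 := div_ne_zero (Polynomial.leadingCoeff_ne_zero.2 hne) (pow_ne_zero _ hl1)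
  refine ⟨-(Polynomial.C c * Polynomial.X ^ k), ?_⟩
  have e0 : axis (shear (-(Polynomial.C c * Polynomial.X ^ k)) * σ) 0 =
      axis σ 0 - Polynomial.C c * axis σ 1 ^ k := by
    rw [axis_mul, shear_coord_zero, map_add, aeval_X, ← Polynomial.aeval_algHom_apply]
    simp [sub_eq_add_neg]
  have e1 : axis (shear (-(Polynomial.C c * Polynomial.X ^ k)) * σ) 1 = axis σ 1 := by
    rw [axis_mul, shear_coord_one, aeval_X]
  rw [e0, e1]
  have hdeg : (Polynomial.C c * axis σ 1 ^ k).natDegree = (axis σ 0).natDegree := by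
    rw [Polynomial.natDegree_C_mul hc0, Polynomial.natDegree_pow, hk, mul_comm]
  have hne2 : Polynomial.C c * axis σ 1 ^ k ≠ 0 :=
    mul_ne_zero (Polynomial.C_ne_zero.2 hc0) (pow_ne_zero _ hne1)
  have hlt : (axis σ 0 - Polynomial.C c * axis σ 1 ^ k).degree < (axis σ 0).degree := by
    apply Polynomial.degree_sub_lt_left _ hne
    · rw [Polynomial.leadingCoeff_mul, Polynomial.leadingCoeff_C, Polynomial.leadingCoeff_pow, hc,
        div_mul_cancel₀ _ (pow_ne_zero _ hl1)]
    · rw [Polynomial.degree_eq_natDegree hne, Polynomial.degree_eq_natDegree hne2, hdeg]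
  by_cases hz : axis σ 0 - Polynomial.C c * axis σ 1 ^ k = 0
  · rw [hz, Polynomial.natDegree_zero]
    omega
  · have := Polynomial.natDegree_lt_natDegree hz hlt
    omega

/-- If neither divides, the degrees are `k n` and `k m` with `n, m ≥ 2` coprime. A coordinate of the
inverse maps the restricted curve to its parameter, so the leading terms must cancel: the leading
form vanishes at the pair of leading coefficients and acquires the forbidden factor. -/
theorem natDegree_axis_dvd_or_dvd {σ : GA2 K} (h0 : 0 < (axis σ 0).natDegree)
    (h1 : 0 < (axis σ 1).natDegree) :
    (axis σ 0).natDegree ∣ (axis σ 1).natDegree ∨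
      (axis σ 1).natDegree ∣ (axis σ 0).natDegree := by
  by_contra! hcon
  obtain ⟨k, n, m, hk, hcop, hn, hm⟩ := Nat.exists_coprime' (Nat.gcd_pos_of_pos_left
    (axis σ 1).natDegree h0)
  rw [mul_comm] at hn hm
  have hn2 : 2 ≤ n := by
    rcases n with _ | _ | n
    · omega
    · exact absurd (by rw [hn, hm]; simp) hcon.1
    · omega
  have hm2 : 2 ≤ m := by
    rcases m with _ | _ | m
    · omega
    · exact absurd (by rw [hn, hm]; simp) hcon.2
    · omega
  set f := σ⁻¹.val.coord with hf
  have haxis : axis σ = ![axis σ 0, axis σ 1] := by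
    funext i
    fin_cases i <;> rfl
  have hfX : aeval ![axis σ 0, axis σ 1] (f 0) = Polynomial.X := by
    rw [← haxis, hf, ← axis_mul, inv_mul_cancel]
    simp [axis, one_coord]
  have hf0 : f 0 ≠ 0 := by
    intro h
    rw [h, map_zero] at hfX
    exact Polynomial.X_ne_zero hfX.symm
  obtain ⟨e, he, hmax⟩ := (f 0).support.exists_max_image (fun d => d 0 * n + d 1 * m)
    (support_nonempty.2 hf0)
  set N := e 0 * n + e 1 * m with hN
  set v : Fin 2 → ℚ := ![(n : ℚ), (m : ℚ)] with hv
  have hweight : ∀ d : Fin 2 →₀ ℕ, Finsupp.weight v d = ((d 0 * n + d 1 * m : ℕ) : ℚ) := by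
    intro d
    rw [weight_fin_two]
    simp [hv]
  have hne : weightedHomogeneousComponent v (N : ℚ) (f 0) ≠ 0 := by
    intro h
    have := congrArg (coeff e) h
    rw [coeff_weightedHomogeneousComponent, if_pos (by rw [hweight]), coeff_zero] at this
    exact mem_support_iff.1 he this
  have hcoeff := coeff_aeval_eq_eval_component hn.le hm.le hmax hk
  -- Both weights are at least 2, so `N ≠ 1`. The coefficient of degree `k N` in the parameter is
  -- then zero.
  have hkN : k * N ≠ 1 := by
    intro h
    have hN1 : N = 1 := Nat.eq_one_of_mul_eq_one_left h
    rcases Nat.eq_zero_or_pos (e 0) with h0 | h0 <;> rcases Nat.eq_zero_or_pos (e 1) with h1 | h1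
    · simp [hN, h0, h1] at hN1
    all_goals nlinarith
  rw [hfX, Polynomial.coeff_X_of_ne_one hkN, ← hn, ← hm] at hcoeff
  have ha : (axis σ 0).coeff (axis σ 0).natDegree ≠ 0 := by
    rw [Polynomial.coeff_natDegree, Polynomial.leadingCoeff_ne_zero]
    rintro h
    simp [h] at h0
  have hb : (axis σ 1).coeff (axis σ 1).natDegree ≠ 0 := by
    rw [Polynomial.coeff_natDegree, Polynomial.leadingCoeff_ne_zero]
    rintro h
    simp [h] at h1
  refine not_pow_sub_pow_dvd_component (aeval_coord_inv σ) (aeval_inv_coord σ) hm2 hn2 hcop.symm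
    (div_ne_zero (pow_ne_zero m ha) (pow_ne_zero n hb)) (v := v) (N := N) (fun d hd => ?_) hne
    (pow_sub_pow_dvd_of_eval_eq_zero (by omega) hcop.symm
      (weightedHomogeneousComponent_isWeightedHomogeneous _ _) ha hb hcoeff.symm)
  rw [hweight]
  exact_mod_cast hmax d hd

theorem mem_closure_affine_union_elementary (σ : GA2 K) :
    σ ∈ Submonoid.closure (affine K ∪ elementary K) := by
  set M := Submonoid.closure (affine K ∪ elementary K) with hM
  have hA : ∀ g ∈ affine K, g ∈ M := fun g hg => Submonoid.subset_closure (Or.inl hg)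
  have hE : ∀ g ∈ elementary K, g ∈ M := fun g hg => Submonoid.subset_closure (Or.inr hg)
  have hswap : ∀ τ : GA2 K, linear (matT K) * τ ∈ M → τ ∈ M := by
    intro τ hτ
    have := M.mul_mem (hA _ (linear_mem_affine (matT K))) hτ
    rwa [← mul_assoc, linear_matT_mul_self, one_mul] at this
  have hshear : ∀ (τ : GA2 K) (P : Polynomial K), shear P * τ ∈ M → τ ∈ M := by
    intro τ P hτ
    have := M.mul_mem (hE _ (inv_shear_mem_elementary P)) hτ
    rwa [inv_mul_cancel_left] at this
  -- The end of the Euclidean algorithm: after a swap, the second coordinate is affine in `y` alone,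
  -- which makes the map elementary.
  have hconst : ∀ τ : GA2 K, (axis τ 0).natDegree = 0 → τ ∈ M := by
    intro τ hτ
    obtain ⟨b, hb, hb'⟩ :=
      coord_zero_of_axis_zero_eq_C (Polynomial.eq_C_of_natDegree_eq_zero hτ)
    refine hswap _ (hE _ (mem_elementary_of_coord_one hb (v := (axis τ 0).coeff 0) ?_))
    rw [Units.val_mul, mul_coord, matT_coord_one, aeval_X, hb']
  generalize hn : (axis σ 0).natDegree + (axis σ 1).natDegree = n
  induction n using Nat.strong_induction_on generalizing σ with
  | _ n ih =>
    subst hn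
    rcases Nat.eq_zero_or_pos (axis σ 0).natDegree with h0 | h0
    · exact hconst σ h0
    rcases Nat.eq_zero_or_pos (axis σ 1).natDegree with h1 | h1
    · exact hswap _ (hconst _ (by rw [axis_swap_mul_zero, h1]))
    rcases natDegree_axis_dvd_or_dvd h0 h1 with h | h
    · obtain ⟨P, hP⟩ := exists_shear_natDegree_lt (σ := linear (matT K) * σ)
        (by rwa [axis_swap_mul_zero]) (by rwa [axis_swap_mul_zero, axis_swap_mul_one])
      refine hswap _ (hshear _ P (ih _ ?_ _ rfl))
      rwa [axis_swap_mul_zero, axis_swap_mul_one, add_comm (axis σ 1).natDegree] at hP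
    · obtain ⟨P, hP⟩ := exists_shear_natDegree_lt h0 h
      exact hshear _ P (ih _ hP _ rfl)

theorem exists_isConj_linear_of_isInvolution (h2 : (2 : K) ≠ 0) {g : GA2 K}
    (hg : IsInvolution g) : ∃ M : GL (Fin 2) K, IsConj g (linear M) := by
  obtain ⟨l, hl, hprod⟩ := Submonoid.exists_list_of_mem_closure
    (mem_closure_affine_union_elementary g)
  obtain ⟨k, hk, hk'⟩ := exists_isConj_mem_or_isPairProduct one_mem_affine
    (fun _ hx _ hy => mul_mem_affine hx hy) (fun _ hx _ hy => mul_mem_elementary hx hy) _ l le_rfl hl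
  rw [hprod] at hk
  have hki := hg.isConj hk
  have : ∃ M : GL (Fin 2) K, IsConj k (linear M) := by
    rcases hk' with (h | h) | h
    · exact exists_isConj_linear_of_affine h2 h hki.1
    · exact exists_isConj_linear_of_elementary h2 h hki.1
    · exact absurd hki.1 (sq_ne_one_of_isPairProduct h)
  obtain ⟨M, hM⟩ := this
  exact ⟨M, hk.trans hM⟩

end GA2
end

theorem mainTheorem10 (K : Type*) [Field K] (hK : ringChar K ≠ 2) :
    -- involutions in the union of the affine and the elementary group
    (∀ g ∈ GA2.affine K ∪ GA2.elementary K, GA2.IsInvolution g →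
      (∃ M : GL (Fin 2) K, IsConj g (GA2.linear M)) ∧
      (IsConj g (GA2.linear (GA2.matI K)) ∨ IsConj g (GA2.linear (GA2.matS K)))) ∧
    -- all involutions of the polynomial automorphism group
    (∀ g : GA2 K, GA2.IsInvolution g →
      (∃ M : GL (Fin 2) K, IsConj g (GA2.linear M)) ∧
      (IsConj g (GA2.linear (GA2.matI K)) ∨ IsConj g (GA2.linear (GA2.matS K)))) ∧
    -- the two normal forms `S` and `T` are interchangeable
    IsConj (GA2.linear (GA2.matS K)) (GA2.linear (GA2.matT K)) ∧
    GA2.linear (GA2.matT K) ∈ GA2.affineReps K := by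
  have h2 : (2 : K) ≠ 0 := Ring.two_ne_zero hK
  have main : ∀ g : GA2 K, GA2.IsInvolution g →
      (∃ M : GL (Fin 2) K, IsConj g (GA2.linear M)) ∧
      (IsConj g (GA2.linear (GA2.matI K)) ∨ IsConj g (GA2.linear (GA2.matS K))) := by
    intro g hg
    obtain ⟨M, hM⟩ := GA2.exists_isConj_linear_of_isInvolution h2 hg
    exact ⟨⟨M, hM⟩, (GA2.isConj_linear_matI_or_matS h2 (hg.isConj hM)).imp hM.trans hM.trans⟩
  refine ⟨fun g _ => main g, main, (GA2.isConj_linear (GA2.isConj_matT_matS h2)).symm,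
    0, GA2.matT K, rfl, rfl⟩
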